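/- \textbf{Definitions.} An \emph{even-tempered game} is an integer or a pair $\{G^L\mid G^R\}$ of finite nonempty sets of odd-tempered games (its left and right options); an \emph{odd-tempered game} is a pair $\{G^L\mid G^R\}$ of finite nonempty sets of even-tempered games. A \emph{(well-tempered scoring) game} is an even-tempered or an odd-tempered game; integers have no options. Two games are equal if they are the same integer or have the same set of left options and the same set of right options. A \emph{subgame} of $G$ is $G$ or a subgame of an option of $G$. The left and right outcomes are $\operatorname{L}(n)=\operatorname{R}(n)=n$ for integers $n$, and otherwise $\operatorname{L}(G)=\max_{G^L}\operatorname{R}(G^L)$, $\operatorname{R}(G)=\min_{G^R}\operatorname{L}(G^R)$. The sum $G+H$ is the usual sum if $G,H$ are both integers, and otherwise $\{G^L+H,\,G+H^L\mid G^R+H,\,G+H^R\}$. Write $G\gtrsim H$ (equivalently $H\lesssim G$) if $\operatorname{L}(G+X)\ge\operatorname{L}(H+X)$ and $\operatorname{R}(G+X)\ge\operatorname{R}(H+X)$ for every game $X$, and $G\approx H$ ($G$ and $H$ are \emph{equivalent}) if both are equalities for every game $X$. A game $G$ is \emph{invertible} (modulo equivalence) if $G+H\approx 0$ for some game $H$.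 Let $\operatorname{gap}_0(G)$ be the supremum of $\operatorname{R}(H)-\operatorname{L}(H)$ over all even-tempered subgames $H$ of $G$, and let $\mathcal I$ be the class of games $G$ with $\operatorname{gap}_0(G)=0$. A left option $G^L$ of $G$ is \emph{reversible} if some right option $G^{LR}$ of $G^L$ satisfies $G^{LR}\lesssim G$, and \emph{dominated} if some other left option $G^{L'}$ of $G$ satisfies $G^{L'}\gtrsim G^L$. A right option $G^R$ of $G$ is \emph{reversible} if some left option $G^{RL}$ of $G^R$ satisfies $G^{RL}\gtrsim G$, and \emph{dominated} if some other right option $G^{R'}$ of $G$ satisfies $G^{R'}\lesssim G^R$. A game in $\mathcal I$ is \emph{canonical} if neither it nor any of its subgames has a reversible or dominated option. \textbf{Theorem.} If $G$ is an invertible well-tempered scoring game, then there is a unique $H\in\mathcal I$ such that $H\approx G$ and $H$ is canonical. -/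

import Mathlib

/-!
# Well-tempered integer-valued scoring games

A (finite) scoring game is an integer or a pair of finite sets of scoring games. Since options form
sets, the type of scoring games is the initial algebra of the functor
`α ↦ ℤ ⊕ (Finset α × Finset α)`; it is obtained as a `QPF.Fix`. In particular `=` on this type is
identity of games: two non-integers are equal iff they have the same set of left options and the
same set of right options.
-/

noncomputable section

/-- The shape of one layer of a scoring game: an integer, or sets of left and of right options. -/
def GameShape (α : Type) : Type := ℤ ⊕ (Finset α × Finset α)

namespace GameShape

open Classical in
instance : Functor GameShape where
  map f
    | Sum.inl n => Sum.inl n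
    | Sum.inr (l, r) => Sum.inr (l.image f, r.image f)

/-- The polynomial functor of which `GameShape` is a quotient: an integer, or a list of `a` left
options and a list of `b` right options. -/
def P : PFunctor where
  A := ℤ ⊕ (ℕ × ℕ)
  B
    | Sum.inl _ => Empty
    | Sum.inr (a, b) => Fin a ⊕ Fin b

open Classical in
/-- Forget the order and the multiplicity of the options in the lists. -/
def abs {α : Type} : P α → GameShape α
  | ⟨Sum.inl n, _⟩ => Sum.inl n
  | ⟨Sum.inr (_, _), f⟩ =>
      Sum.inr (Finset.univ.image fun i => f (Sum.inl i), Finset.univ.image fun j => f (Sum.inr j))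

/-- List the options in an arbitrary order. -/
def repr {α : Type} : GameShape α → P α
  | Sum.inl n => ⟨Sum.inl n, fun e => nomatch e⟩
  | Sum.inr (l, r) => ⟨Sum.inr (l.card, r.card),
      fun i => Sum.elim (fun i => (l.equivFin.symm i).1) (fun j => (r.equivFin.symm j).1) i⟩

open Classical in
instance : QPF GameShape where
  P := P
  abs := abs
  repr := repr
  abs_repr := by
    rintro α (n | ⟨l, r⟩)
    · rfl
    · have key : ∀ s : Finset α,
          Finset.univ.image (fun i => (s.equivFin.symm i).1) = s := by
        intro s
        ext x
        simp only [Finset.mem_image, Finset.mem_univ, true_and]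
        constructor
        · rintro ⟨i, rfl⟩
          exact (s.equivFin.symm i).2
        · intro hx
          exact ⟨s.equivFin ⟨x, hx⟩, by simp⟩
      exact congrArg Sum.inr (Prod.ext (key l) (key r))
  abs_map := by
    rintro α β f ⟨n | ⟨a, b⟩, g⟩
    · rfl
    · refine congrArg Sum.inr (Prod.ext ?_ ?_)
      · exact Finset.image_image.symm
      · exact Finset.image_image.symm

end GameShape

/-- Integer-valued scoring games with finitely many options (not necessarily well-tempered). -/
def ScoringGame : Type := QPF.Fix GameShape

namespace ScoringGame

instance : DecidableEq ScoringGame := Classical.decEq _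

/-- The integer `n`, as a game that is over. -/
def int (n : ℤ) : ScoringGame := QPF.Fix.mk (F := GameShape) (Sum.inl n)

/-- The game `{l | r}`. -/
def node (l r : Finset ScoringGame) : ScoringGame := QPF.Fix.mk (F := GameShape) (Sum.inr (l, r))

/-- A game is an integer or a pair of sets of options. -/
def dest (G : ScoringGame) : ℤ ⊕ (Finset ScoringGame × Finset ScoringGame) :=
  QPF.Fix.dest (F := GameShape) G

@[simp] theorem dest_int (n : ℤ) : (int n).dest = Sum.inl n :=
  QPF.Fix.dest_mk (F := GameShape) _

@[simp] theorem dest_node (l r : Finset ScoringGame) : (node l r).dest = Sum.inr (l, r) :=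
  QPF.Fix.dest_mk (F := GameShape) _

theorem eq_int_or_node (G : ScoringGame) : (∃ n, G = int n) ∨ ∃ l r, G = node l r := by
  have h : QPF.Fix.mk (F := GameShape) G.dest = G := QPF.Fix.mk_dest (F := GameShape) G
  rcases hd : G.dest with n | ⟨l, r⟩
  · exact Or.inl ⟨n, by rw [← h, hd]; rfl⟩
  · exact Or.inr ⟨l, r, by rw [← h, hd]; rfl⟩

/-- The set of left options `G^L` (empty for an integer). -/
def left (G : ScoringGame) : Finset ScoringGame :=
  match G.dest with
  | Sum.inl _ => ∅
  | Sum.inr (l, _) => l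

/-- The set of right options `G^R` (empty for an integer). -/
def right (G : ScoringGame) : Finset ScoringGame :=
  match G.dest with
  | Sum.inl _ => ∅
  | Sum.inr (_, r) => r

@[simp] theorem left_int (n : ℤ) : (int n).left = ∅ := by simp [left]
@[simp] theorem right_int (n : ℤ) : (int n).right = ∅ := by simp [right]
@[simp] theorem left_node (l r : Finset ScoringGame) : (node l r).left = l := by simp [left]
@[simp] theorem right_node (l r : Finset ScoringGame) : (node l r).right = r := by simp [right]

/-- One step of the computation of the height. -/
def heightStep : GameShape ℕ → ℕ
  | Sum.inl _ => 0
  | Sum.inr (l, r) => (l ∪ r).sup id + 1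

/-- The height of the game tree, used only to justify recursive definitions. -/
def height : ScoringGame → ℕ := QPF.Fix.rec (F := GameShape) heightStep

theorem height_node (l r : Finset ScoringGame) :
    (node l r).height = (l.image height ∪ r.image height).sup id + 1 := by
  refine (QPF.Fix.rec_eq (F := GameShape) heightStep (Sum.inr (l, r))).trans ?_
  change heightStep (Sum.inr (@Finset.image _ _ (fun a b => Classical.propDecidable (a = b)) height l,
    @Finset.image _ _ (fun a b => Classical.propDecidable (a = b)) height r)) = _
  simp only [heightStep]
  congr!

theorem height_lt_of_mem_left {G K : ScoringGame} (h : K ∈ G.left) : K.height < G.height := by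
  rcases G.eq_int_or_node with ⟨n, rfl⟩ | ⟨l, r, rfl⟩
  · simp at h
  · rw [left_node] at h
    rw [height_node, Nat.lt_succ_iff]
    exact Finset.le_sup (f := id)
      (Finset.mem_union_left _ (Finset.mem_image_of_mem height h))

theorem height_lt_of_mem_right {G K : ScoringGame} (h : K ∈ G.right) : K.height < G.height := by
  rcases G.eq_int_or_node with ⟨n, rfl⟩ | ⟨l, r, rfl⟩
  · simp at h
  · rw [right_node] at h
    rw [height_node, Nat.lt_succ_iff]
    exact Finset.le_sup (f := id)
      (Finset.mem_union_right _ (Finset.mem_image_of_mem height h))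

mutual

/-- Even-tempered games. -/
inductive IsEven : ScoringGame → Prop
  | int (n : ℤ) : IsEven (int n)
  | node (l r : Finset ScoringGame) (hl : l.Nonempty) (hr : r.Nonempty)
      (hlo : ∀ K ∈ l, IsOdd K) (hro : ∀ K ∈ r, IsOdd K) : IsEven (node l r)

/-- Odd-tempered games. -/
inductive IsOdd : ScoringGame → Prop
  | node (l r : Finset ScoringGame) (hl : l.Nonempty) (hr : r.Nonempty)
      (hle : ∀ K ∈ l, IsEven K) (hre : ∀ K ∈ r, IsEven K) : IsOdd (node l r)

end

/-- A well-tempered game is an even-tempered game or an odd-tempered game. -/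
def IsWellTempered (G : ScoringGame) : Prop := G.IsEven ∨ G.IsOdd

mutual

/-- The left outcome `L(G)`: the value of an integer, otherwise the maximum of `R(G^L)` over the
left options. (The value `0` for a game that is no integer and has no left option is never used:
such a game is not well-tempered.) -/
def leftOutcome (G : ScoringGame) : ℤ :=
  match G.dest with
  | Sum.inl n => n
  | Sum.inr _ =>
    if h : G.left.attach.Nonempty then
      G.left.attach.sup' h fun K => rightOutcome K.1
    else 0
termination_by G.height
decreasing_by exact height_lt_of_mem_left K.2

/-- The right outcome `R(G)`: the value of an integer, otherwise the minimum of `L(G^R)` over the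
right options (with an unused default value, as for `leftOutcome`). -/
def rightOutcome (G : ScoringGame) : ℤ :=
  match G.dest with
  | Sum.inl n => n
  | Sum.inr _ =>
    if h : G.right.attach.Nonempty then
      G.right.attach.inf' h fun K => leftOutcome K.1
    else 0
termination_by G.height
decreasing_by exact height_lt_of_mem_right K.2

end

/-- The disjunctive sum: the sum of integers if both games are integers, and otherwise
`{G^L + H, G + H^L | G^R + H, G + H^R}`. -/
def add (G H : ScoringGame) : ScoringGame :=
  match G.dest, H.dest with
  | Sum.inl m, Sum.inl n => int (m + n)
  | _, _ =>
    node
      (G.left.attach.image (fun K => add K.1 H) ∪ H.left.attach.image (fun K => add G K.1))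
      (G.right.attach.image (fun K => add K.1 H) ∪ H.right.attach.image (fun K => add G K.1))
termination_by G.height + H.height
decreasing_by
  · exact Nat.add_lt_add_right (height_lt_of_mem_left K.2) _
  · exact Nat.add_lt_add_left (height_lt_of_mem_left K.2) _
  · exact Nat.add_lt_add_right (height_lt_of_mem_right K.2) _
  · exact Nat.add_lt_add_left (height_lt_of_mem_right K.2) _

instance : Add ScoringGame := ⟨add⟩

/-- `G ≳ H`: both outcomes of `G + X` are at least those of `H + X`, for all well-tempered `X`. -/
def Ge (G H : ScoringGame) : Prop :=
  ∀ X : ScoringGame, X.IsWellTempered →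
    (H + X).leftOutcome ≤ (G + X).leftOutcome ∧ (H + X).rightOutcome ≤ (G + X).rightOutcome

/-- `G ≈ H`: the outcomes of `G + X` and `H + X` agree, for all well-tempered `X`. -/
def Equivalent (G H : ScoringGame) : Prop :=
  ∀ X : ScoringGame, X.IsWellTempered →
    (G + X).leftOutcome = (H + X).leftOutcome ∧ (G + X).rightOutcome = (H + X).rightOutcome

/-- `G` is invertible modulo equivalence: `G + H ≈ 0` for some well-tempered game `H`. -/
def IsInvertible (G : ScoringGame) : Prop :=
  ∃ H : ScoringGame, H.IsWellTempered ∧ Equivalent (G + H) (int 0)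

/-- `IsSubgame H G`: `H` is a subgame of `G`, i.e. `H` is `G` or a subgame of an option of `G`. -/
inductive IsSubgame (H : ScoringGame) : ScoringGame → Prop
  | refl : IsSubgame H H
  | left {G K : ScoringGame} (hK : K ∈ G.left) (h : IsSubgame H K) : IsSubgame H G
  | right {G K : ScoringGame} (hK : K ∈ G.right) (h : IsSubgame H K) : IsSubgame H G

/-- The even gap `gap₀(G)`: the supremum of `R(H) - L(H)` over the even-tempered subgames `H`. -/
def evenGap (G : ScoringGame) : EReal :=
  ⨆ (H : ScoringGame) (_ : IsSubgame H G) (_ : H.IsEven),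
    (((H.rightOutcome - H.leftOutcome : ℤ) : ℝ) : EReal)

/-- The class `I` of well-tempered games with even gap zero. -/
def classI : Set ScoringGame := {G | G.IsWellTempered ∧ G.evenGap = 0}

/-- The left option `K` of `G` is reversible: some right option of `K` is `≲ G`. -/
def LeftReversible (G K : ScoringGame) : Prop := ∃ M ∈ K.right, Ge G M

/-- The right option `K` of `G` is reversible: some left option of `K` is `≳ G`. -/
def RightReversible (G K : ScoringGame) : Prop := ∃ M ∈ K.left, Ge M G

/-- The left option `K` of `G` is dominated: some other left option of `G` is `≳ K`. -/
def LeftDominated (G K : ScoringGame) : Prop := ∃ M ∈ G.left, M ≠ K ∧ Ge M K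

/-- The right option `K` of `G` is dominated: some other right option of `G` is `≲ K`. -/
def RightDominated (G K : ScoringGame) : Prop := ∃ M ∈ G.right, M ≠ K ∧ Ge K M

/-- `G` lies in `I`, and no subgame of `G` has a reversible or a dominated option. -/
def IsCanonical (G : ScoringGame) : Prop :=
  G ∈ classI ∧ ∀ H : ScoringGame, IsSubgame H G →
    (∀ K ∈ H.left, ¬ LeftReversible H K ∧ ¬ LeftDominated H K) ∧
    (∀ K ∈ H.right, ¬ RightReversible H K ∧ ¬ RightDominated H K)

end ScoringGame

end

namespace ScoringGame

-- The class `classI` behaves like the group of combinatorial games. If `R ≤ L` on every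
-- even-tempered subgame, then no player is hurt by having to open an even-tempered component. Hence
-- an even-tempered `K` in `classI` with `c ≤ R(K)` is `≳ c`: Left plays well elsewhere and answers
-- Right inside `K` (`outcomes_add_ge_of_le_rightOutcome`). The class is closed under sums and
-- negation, the mirror strategy gives `G + -G ≈ 0`, and `G ≳ H` for equal parities reduces to `0 ≤
-- R(G + -H)`, a condition on moves (`ge_iff_rightOutcome_nonneg`, `ge_of_moves`).
--
-- An arbitrary game `G` has an upside `U` in `classI`, which cannot be told apart from `G` in sums
-- where Left moves last (`exists_mem_classI_upLe`): options are replaced recursively, and an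
-- even-tempered result with `L < R` is replaced by the integer `R`. An upside `V` of `-G` gives the
-- downside `-V`, which serves when Right moves last. Always `U ≳ -V`. If `G + H ≈ 0`, the upsides
-- of `G` and `H` sum to zero, and so do the downsides; since the upside of `H` is also `≳` its
-- downside, this forces `U ≈ -V`. So `U` agrees with `G` in all sums, and `U ≈ G`.
--
-- Uniqueness of the canonical form is the classical argument: without reversible or dominated
-- options, equivalent games have pairwise equivalent options, which are equal by induction.
-- Parities agree because large cold games separate even from odd. For existence, a game of least
-- tree size among the members of `classI` in its equivalence class is canonical: deleting a
-- dominated option or bypassing a reversible one would shrink it. The delicate points are to remain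
-- inside `classI` and to bypass through an integer, which has no options to inherit.

-- Induction on options; integers versus pairs.

theorem option_induction {P : ScoringGame → Prop}
    (h : ∀ G : ScoringGame, (∀ K ∈ G.left, P K) → (∀ K ∈ G.right, P K) → P G) (G : ScoringGame) :
    P G := by
  induction hn : G.height using Nat.strong_induction_on generalizing G with
  | _ n ih =>
    subst hn
    exact h G (fun K hK => ih _ (height_lt_of_mem_left hK) K rfl)
      (fun K hK => ih _ (height_lt_of_mem_right hK) K rfl)

/-- The game is an integer. -/
def IsInt (G : ScoringGame) : Prop := ∃ n, G = int n

theorem isInt_int (n : ℤ) : (int n).IsInt := ⟨n, rfl⟩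

theorem not_isInt_node (l r : Finset ScoringGame) : ¬ (node l r).IsInt := by
  rintro ⟨n, hn⟩
  have := congrArg dest hn
  simp at this

theorem not_isInt_of_mem_left {G K : ScoringGame} (h : K ∈ G.left) : ¬ G.IsInt := by
  rintro ⟨n, rfl⟩
  simp at h

theorem ext_of_not_isInt {G H : ScoringGame} (hG : ¬ G.IsInt) (hH : ¬ H.IsInt)
    (hl : G.left = H.left) (hr : G.right = H.right) : G = H := by
  rcases G.eq_int_or_node with h | ⟨l, r, rfl⟩
  · exact absurd h hG
  rcases H.eq_int_or_node with h | ⟨l', r', rfl⟩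
  · exact absurd h hH
  simp only [left_node, right_node] at hl hr
  rw [hl, hr]

/-! ### Sums -/

theorem int_add_int (m n : ℤ) : int m + int n = int (m + n) := by
  change add _ _ = _
  rw [add.eq_def]
  simp

theorem add_eq_node {G H : ScoringGame} (h : ¬ (G.IsInt ∧ H.IsInt)) :
    G + H = node (G.left.image (· + H) ∪ H.left.image (G + ·))
      (G.right.image (· + H) ∪ H.right.image (G + ·)) := by
  have key : ∀ (s : Finset ScoringGame) (f : ScoringGame → ScoringGame),
      s.attach.image (fun K => f K.1) = s.image f := by
    intro s f
    ext x
    simp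
  change add _ _ = _
  rw [add.eq_def]
  rcases G.eq_int_or_node with ⟨m, rfl⟩ | ⟨l, r, rfl⟩ <;>
  rcases H.eq_int_or_node with ⟨n, rfl⟩ | ⟨l', r', rfl⟩
  · exact absurd ⟨isInt_int m, isInt_int n⟩ h
  all_goals
    simp only [dest_int, dest_node]
    rw [key _ (fun K => add K _), key _ (fun K => add _ K), key _ (fun K => add K _),
      key _ (fun K => add _ K)]
    rfl

theorem isInt_add_iff {G H : ScoringGame} : (G + H).IsInt ↔ G.IsInt ∧ H.IsInt := by
  constructor
  · intro h
    by_contra h'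
    rw [add_eq_node h'] at h
    exact not_isInt_node _ _ h
  · rintro ⟨⟨m, rfl⟩, ⟨n, rfl⟩⟩
    exact ⟨_, int_add_int m n⟩

theorem left_add (G H : ScoringGame) :
    (G + H).left = G.left.image (· + H) ∪ H.left.image (G + ·) := by
  by_cases h : G.IsInt ∧ H.IsInt
  · obtain ⟨⟨m, rfl⟩, ⟨n, rfl⟩⟩ := h
    simp [int_add_int]
  · rw [add_eq_node h, left_node]

theorem right_add (G H : ScoringGame) :
    (G + H).right = G.right.image (· + H) ∪ H.right.image (G + ·) := by
  by_cases h : G.IsInt ∧ H.IsInt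
  · obtain ⟨⟨m, rfl⟩, ⟨n, rfl⟩⟩ := h
    simp [int_add_int]
  · rw [add_eq_node h, right_node]

theorem mem_left_add {G H K : ScoringGame} :
    K ∈ (G + H).left ↔ (∃ A ∈ G.left, A + H = K) ∨ ∃ B ∈ H.left, G + B = K := by
  simp [left_add]

theorem mem_right_add {G H K : ScoringGame} :
    K ∈ (G + H).right ↔ (∃ A ∈ G.right, A + H = K) ∨ ∃ B ∈ H.right, G + B = K := by
  simp [right_add]

theorem add_mem_left_of_left {G A : ScoringGame} (hA : A ∈ G.left) (H : ScoringGame) :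
    A + H ∈ (G + H).left := mem_left_add.2 (Or.inl ⟨A, hA, rfl⟩)

theorem add_mem_left_of_right {H B : ScoringGame} (hB : B ∈ H.left) (G : ScoringGame) :
    G + B ∈ (G + H).left := mem_left_add.2 (Or.inr ⟨B, hB, rfl⟩)

theorem add_mem_right_of_left {G A : ScoringGame} (hA : A ∈ G.right) (H : ScoringGame) :
    A + H ∈ (G + H).right := mem_right_add.2 (Or.inl ⟨A, hA, rfl⟩)

theorem add_mem_right_of_right {H B : ScoringGame} (hB : B ∈ H.right) (G : ScoringGame) :
    G + B ∈ (G + H).right := mem_right_add.2 (Or.inr ⟨B, hB, rfl⟩)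

theorem game_add_comm (G H : ScoringGame) : G + H = H + G := by
  induction G using option_induction generalizing H with
  | _ G ihl ihr =>
  induction H using option_induction with
  | _ H jhl jhr =>
  by_cases h : G.IsInt ∧ H.IsInt
  · obtain ⟨⟨m, rfl⟩, ⟨n, rfl⟩⟩ := h
    rw [int_add_int, int_add_int, add_comm]
  · refine ext_of_not_isInt (by rwa [isInt_add_iff]) (by rwa [isInt_add_iff, and_comm]) ?_ ?_
    · rw [left_add, left_add, Finset.union_comm, Finset.image_congr fun K hK => jhl K hK,
        Finset.image_congr fun K hK => ihl K hK H]
    · rw [right_add, right_add, Finset.union_comm, Finset.image_congr fun K hK => jhr K hK,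
        Finset.image_congr fun K hK => ihr K hK H]

theorem game_add_assoc (G H J : ScoringGame) : G + H + J = G + (H + J) := by
  induction G using option_induction generalizing H J with
  | _ G ihl ihr =>
  induction H using option_induction generalizing J with
  | _ H jhl jhr =>
  induction J using option_induction with
  | _ J khl khr =>
  by_cases h : (G.IsInt ∧ H.IsInt) ∧ J.IsInt
  · obtain ⟨⟨⟨m, rfl⟩, ⟨n, rfl⟩⟩, ⟨k, rfl⟩⟩ := h
    simp only [int_add_int, add_assoc]
  · refine ext_of_not_isInt (by rwa [isInt_add_iff, isInt_add_iff])
      (by rwa [isInt_add_iff, isInt_add_iff, ← and_assoc]) ?_ ?_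
    · simp only [left_add, Finset.image_union, Finset.image_image, ← Finset.union_assoc]
      refine congrArg₂ _ (congrArg₂ _ ?_ ?_) ?_ <;> refine Finset.image_congr fun K hK => ?_
      · exact ihl K hK H J
      · exact jhl K hK J
      · exact khl K hK
    · simp only [right_add, Finset.image_union, Finset.image_image, ← Finset.union_assoc]
      refine congrArg₂ _ (congrArg₂ _ ?_ ?_) ?_ <;> refine Finset.image_congr fun K hK => ?_
      · exact ihr K hK H J
      · exact jhr K hK J
      · exact khr K hK

theorem int_zero_add (G : ScoringGame) : int 0 + G = G := by
  induction G using option_induction with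
  | _ G ihl ihr =>
  by_cases h : G.IsInt
  · obtain ⟨n, rfl⟩ := h
    rw [int_add_int, zero_add]
  · refine ext_of_not_isInt (by rw [isInt_add_iff]; tauto) h ?_ ?_
    · rw [left_add, Finset.image_congr (g := id) fun K hK => ihl K hK]
      simp
    · rw [right_add, Finset.image_congr (g := id) fun K hK => ihr K hK]
      simp

noncomputable instance : Zero ScoringGame := ⟨int 0⟩

noncomputable instance : AddCommMonoid ScoringGame where
  add_assoc := game_add_assoc
  add_comm := game_add_comm
  zero_add := int_zero_add
  add_zero G := (game_add_comm G _).trans (int_zero_add G)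
  nsmul := nsmulRec

theorem zero_def : (0 : ScoringGame) = int 0 := rfl

/-! ### Negation -/

/-- The negative of a game: the players exchange their roles. -/
noncomputable def neg (G : ScoringGame) : ScoringGame :=
  match G.dest with
  | Sum.inl n => int (-n)
  | Sum.inr _ =>
    node (G.right.attach.image fun K => neg K.1) (G.left.attach.image fun K => neg K.1)
termination_by G.height
decreasing_by
  · exact height_lt_of_mem_right K.2
  · exact height_lt_of_mem_left K.2

noncomputable instance : Neg ScoringGame := ⟨neg⟩

theorem neg_int (n : ℤ) : -int n = int (-n) := by
  change neg _ = _
  rw [neg.eq_def]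
  simp

theorem neg_node (l r : Finset ScoringGame) :
    -node l r = node (r.image (- ·)) (l.image (- ·)) := by
  have key : ∀ (s : Finset ScoringGame) (f : ScoringGame → ScoringGame),
      s.attach.image (fun K => f K.1) = s.image f := by
    intro s f
    ext x
    simp
  change neg _ = _
  rw [neg.eq_def]
  simp only [dest_node]
  rw [key _ neg, key _ neg, left_node, right_node]
  rfl

theorem left_neg (G : ScoringGame) : (-G).left = G.right.image (- ·) := by
  rcases G.eq_int_or_node with ⟨m, rfl⟩ | ⟨l, r, rfl⟩
  · simp [neg_int]
  · simp [neg_node]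

theorem right_neg (G : ScoringGame) : (-G).right = G.left.image (- ·) := by
  rcases G.eq_int_or_node with ⟨m, rfl⟩ | ⟨l, r, rfl⟩
  · simp [neg_int]
  · simp [neg_node]

theorem isInt_neg_iff {G : ScoringGame} : (-G).IsInt ↔ G.IsInt := by
  rcases G.eq_int_or_node with ⟨m, rfl⟩ | ⟨l, r, rfl⟩
  · exact iff_of_true ⟨_, neg_int m⟩ (isInt_int m)
  · rw [neg_node]
    exact iff_of_false (not_isInt_node _ _) (not_isInt_node _ _)

noncomputable instance : InvolutiveNeg ScoringGame where
  neg_neg G := by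
    induction G using option_induction with
    | _ G ihl ihr =>
    by_cases h : G.IsInt
    · obtain ⟨n, rfl⟩ := h
      rw [neg_int, neg_int, neg_neg]
    · refine ext_of_not_isInt (by rwa [isInt_neg_iff, isInt_neg_iff]) h ?_ ?_
      · rw [left_neg, right_neg, Finset.image_image]
        exact (Finset.image_congr (g := id) fun K hK => ihl K hK).trans Finset.image_id
      · rw [right_neg, left_neg, Finset.image_image]
        exact (Finset.image_congr (g := id) fun K hK => ihr K hK).trans Finset.image_id

theorem mem_left_neg {G K : ScoringGame} : K ∈ (-G).left ↔ -K ∈ G.right := by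
  rw [left_neg, Finset.mem_image]
  exact ⟨fun ⟨A, hA, h⟩ => by rwa [← h, neg_neg], fun h => ⟨_, h, neg_neg K⟩⟩

theorem mem_right_neg {G K : ScoringGame} : K ∈ (-G).right ↔ -K ∈ G.left := by
  rw [right_neg, Finset.mem_image]
  exact ⟨fun ⟨A, hA, h⟩ => by rwa [← h, neg_neg], fun h => ⟨_, h, neg_neg K⟩⟩

theorem neg_mem_left_neg {G K : ScoringGame} : -K ∈ (-G).left ↔ K ∈ G.right := by
  rw [mem_left_neg, neg_neg]

theorem neg_mem_right_neg {G K : ScoringGame} : -K ∈ (-G).right ↔ K ∈ G.left := by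
  rw [mem_right_neg, neg_neg]

theorem game_neg_add (G H : ScoringGame) : -(G + H) = -G + -H := by
  induction G using option_induction generalizing H with
  | _ G ihl ihr =>
  induction H using option_induction with
  | _ H jhl jhr =>
  by_cases h : G.IsInt ∧ H.IsInt
  · obtain ⟨⟨m, rfl⟩, ⟨n, rfl⟩⟩ := h
    simp only [int_add_int, neg_int, neg_add]
  · refine ext_of_not_isInt (by rwa [isInt_neg_iff, isInt_add_iff])
      (by rwa [isInt_add_iff, isInt_neg_iff, isInt_neg_iff]) ?_ ?_
    · simp only [left_neg, left_add, right_add, Finset.image_union, Finset.image_image]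
      refine congrArg₂ _ ?_ ?_ <;> refine Finset.image_congr fun K hK => ?_
      · exact ihr K hK H
      · exact jhr K hK
    · simp only [right_neg, left_add, right_add, Finset.image_union, Finset.image_image]
      refine congrArg₂ _ ?_ ?_ <;> refine Finset.image_congr fun K hK => ?_
      · exact ihl K hK H
      · exact jhl K hK

/-! ### Outcomes -/

@[simp] theorem leftOutcome_int (n : ℤ) : (int n).leftOutcome = n := by
  rw [leftOutcome.eq_def]
  simp

@[simp] theorem rightOutcome_int (n : ℤ) : (int n).rightOutcome = n := by
  rw [rightOutcome.eq_def]
  simp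

theorem leftOutcome_eq_sup' {G : ScoringGame} (h : G.left.attach.Nonempty) :
    G.leftOutcome = G.left.attach.sup' h fun K => rightOutcome K.1 := by
  rw [leftOutcome.eq_def]
  rcases G.eq_int_or_node with ⟨m, rfl⟩ | ⟨l, r, rfl⟩
  · simp at h
  · simp only [dest_node]
    rw [dif_pos h]

theorem rightOutcome_eq_inf' {G : ScoringGame} (h : G.right.attach.Nonempty) :
    G.rightOutcome = G.right.attach.inf' h fun K => leftOutcome K.1 := by
  rw [rightOutcome.eq_def]
  rcases G.eq_int_or_node with ⟨m, rfl⟩ | ⟨l, r, rfl⟩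
  · simp at h
  · simp only [dest_node]
    rw [dif_pos h]

theorem rightOutcome_le_of_mem_left {G K : ScoringGame} (h : K ∈ G.left) :
    K.rightOutcome ≤ G.leftOutcome := by
  have hne : G.left.attach.Nonempty := ⟨⟨K, h⟩, Finset.mem_attach _ _⟩
  rw [leftOutcome_eq_sup' hne]
  exact Finset.le_sup' (fun K : {x // x ∈ G.left} => rightOutcome K.1)
    (Finset.mem_attach _ (⟨K, h⟩ : {x // x ∈ G.left}))

theorem rightOutcome_le_of_mem_right {G K : ScoringGame} (h : K ∈ G.right) :
    G.rightOutcome ≤ K.leftOutcome := by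
  have hne : G.right.attach.Nonempty := ⟨⟨K, h⟩, Finset.mem_attach _ _⟩
  rw [rightOutcome_eq_inf' hne]
  exact Finset.inf'_le (fun K : {x // x ∈ G.right} => leftOutcome K.1)
    (Finset.mem_attach _ (⟨K, h⟩ : {x // x ∈ G.right}))

theorem exists_leftOutcome_eq {G : ScoringGame} (h : G.left.Nonempty) :
    ∃ K ∈ G.left, G.leftOutcome = K.rightOutcome := by
  have hne : G.left.attach.Nonempty := by simpa using h
  obtain ⟨K, -, hK⟩ := Finset.exists_mem_eq_sup' hne
    (fun K : {x // x ∈ G.left} => rightOutcome K.1)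
  exact ⟨K.1, K.2, (leftOutcome_eq_sup' hne).trans hK⟩

theorem exists_rightOutcome_eq {G : ScoringGame} (h : G.right.Nonempty) :
    ∃ K ∈ G.right, G.rightOutcome = K.leftOutcome := by
  have hne : G.right.attach.Nonempty := by simpa using h
  obtain ⟨K, -, hK⟩ := Finset.exists_mem_eq_inf' hne
    (fun K : {x // x ∈ G.right} => leftOutcome K.1)
  exact ⟨K.1, K.2, (rightOutcome_eq_inf' hne).trans hK⟩

theorem le_rightOutcome {G : ScoringGame} (h : G.right.Nonempty) {c : ℤ}
    (hc : ∀ K ∈ G.right, c ≤ K.leftOutcome) : c ≤ G.rightOutcome := by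
  obtain ⟨K, hK, e⟩ := exists_rightOutcome_eq h
  exact e ▸ hc K hK

theorem leftOutcome_le {G : ScoringGame} (h : G.left.Nonempty) {c : ℤ}
    (hc : ∀ K ∈ G.left, K.rightOutcome ≤ c) : G.leftOutcome ≤ c := by
  obtain ⟨K, hK, e⟩ := exists_leftOutcome_eq h
  exact e ▸ hc K hK

/-! ### Parity -/

/-- `Tempered false` means even-tempered and `Tempered true` means odd-tempered. -/
def Tempered : Bool → ScoringGame → Prop
  | false => IsEven
  | true => IsOdd

theorem tempered_int (n : ℤ) : Tempered false (int n) := IsEven.int n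

theorem Tempered.isInt_or {p : Bool} {G : ScoringGame} (h : Tempered p G) :
    (p = false ∧ G.IsInt) ∨ (G.left.Nonempty ∧ G.right.Nonempty) := by
  cases p
  · cases h with
    | int n => exact Or.inl ⟨rfl, isInt_int n⟩
    | node l r hl hr => exact Or.inr (by simpa using ⟨hl, hr⟩)
  · cases h with
    | node l r hl hr => exact Or.inr (by simpa using ⟨hl, hr⟩)

theorem Tempered.of_mem_left {p : Bool} {G K : ScoringGame} (h : Tempered p G)
    (hK : K ∈ G.left) : Tempered (!p) K := by
  cases p
  · cases h with
    | int n => simp at hK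
    | node l r hl hr hlo hro => exact hlo K (by simpa using hK)
  · cases h with
    | node l r hl hr hlo hro => exact hlo K (by simpa using hK)

theorem Tempered.of_mem_right {p : Bool} {G K : ScoringGame} (h : Tempered p G)
    (hK : K ∈ G.right) : Tempered (!p) K := by
  cases p
  · cases h with
    | int n => simp at hK
    | node l r hl hr hlo hro => exact hro K (by simpa using hK)
  · cases h with
    | node l r hl hr hlo hro => exact hro K (by simpa using hK)

theorem tempered_of_options {p : Bool} {G : ScoringGame} (hl : G.left.Nonempty)
    (hr : G.right.Nonempty) (hlo : ∀ K ∈ G.left, Tempered (!p) K)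
    (hro : ∀ K ∈ G.right, Tempered (!p) K) : Tempered p G := by
  rcases G.eq_int_or_node with ⟨m, rfl⟩ | ⟨l, r, rfl⟩
  · simp at hl
  · simp only [left_node, right_node] at hl hr hlo hro
    cases p
    · exact IsEven.node l r hl hr hlo hro
    · exact IsOdd.node l r hl hr hlo hro

theorem Tempered.unique {p q : Bool} {G : ScoringGame} (hp : Tempered p G) (hq : Tempered q G) :
    p = q := by
  induction G using option_induction generalizing p q with
  | _ G ihl ihr =>
  rcases hp.isInt_or with ⟨rfl, hi⟩ | ⟨⟨K, hK⟩, -⟩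
  · rcases hq.isInt_or with ⟨rfl, -⟩ | ⟨⟨K, hK⟩, -⟩
    · rfl
    · exact absurd hi (not_isInt_of_mem_left hK)
  · simpa using ihl K hK (hp.of_mem_left hK) (hq.of_mem_left hK)

theorem isWellTempered_iff {G : ScoringGame} : G.IsWellTempered ↔ ∃ p, Tempered p G := by
  simp [IsWellTempered, Tempered]

theorem Tempered.isWellTempered {p : Bool} {G : ScoringGame} (h : Tempered p G) :
    G.IsWellTempered := isWellTempered_iff.2 ⟨p, h⟩

theorem Tempered.add {p q : Bool} {G H : ScoringGame} (hG : Tempered p G) (hH : Tempered q H) :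
    Tempered (p ^^ q) (G + H) := by
  induction G using option_induction generalizing H p q with
  | _ G ihl ihr =>
  induction H using option_induction generalizing q with
  | _ H jhl jhr =>
  by_cases h : G.IsInt ∧ H.IsInt
  · obtain ⟨⟨m, rfl⟩, ⟨n, rfl⟩⟩ := h
    rw [hG.unique (tempered_int m), hH.unique (tempered_int n), int_add_int]
    exact tempered_int _
  · have hne : (G + H).left.Nonempty ∧ (G + H).right.Nonempty := by
      rcases hG.isInt_or with ⟨-, hi⟩ | ⟨⟨A, hA⟩, ⟨B, hB⟩⟩
      · rcases hH.isInt_or with ⟨-, hj⟩ | ⟨⟨A, hA⟩, ⟨B, hB⟩⟩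
        · exact absurd ⟨hi, hj⟩ h
        · exact ⟨⟨_, add_mem_left_of_right hA G⟩, ⟨_, add_mem_right_of_right hB G⟩⟩
      · exact ⟨⟨_, add_mem_left_of_left hA H⟩, ⟨_, add_mem_right_of_left hB H⟩⟩
    refine tempered_of_options hne.1 hne.2 ?_ ?_
    · intro K hK
      rcases mem_left_add.1 hK with ⟨A, hA, rfl⟩ | ⟨B, hB, rfl⟩
      · simpa using ihl A hA (hG.of_mem_left hA) hH
      · simpa using jhl B hB (hH.of_mem_left hB)
    · intro K hK
      rcases mem_right_add.1 hK with ⟨A, hA, rfl⟩ | ⟨B, hB, rfl⟩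
      · simpa using ihr A hA (hG.of_mem_right hA) hH
      · simpa using jhr B hB (hH.of_mem_right hB)

theorem Tempered.neg {p : Bool} {G : ScoringGame} (hG : Tempered p G) : Tempered p (-G) := by
  induction G using option_induction generalizing p with
  | _ G ihl ihr =>
  rcases hG.isInt_or with ⟨rfl, ⟨n, rfl⟩⟩ | ⟨hl, hr⟩
  · rw [neg_int]
    exact tempered_int _
  · refine tempered_of_options (by rw [left_neg]; exact hr.image _)
      (by rw [right_neg]; exact hl.image _) ?_ ?_
    · intro K hK
      have hK' := mem_left_neg.1 hK
      simpa using ihr _ hK' (hG.of_mem_right hK')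
    · intro K hK
      have hK' := mem_right_neg.1 hK
      simpa using ihl _ hK' (hG.of_mem_left hK')

theorem Tempered.nonempty_of_true {G : ScoringGame} (hG : Tempered true G) :
    G.left.Nonempty ∧ G.right.Nonempty := by
  rcases hG.isInt_or with ⟨h, -⟩ | h
  · exact absurd h (by decide)
  · exact h

theorem IsWellTempered.add {G H : ScoringGame} (hG : G.IsWellTempered) (hH : H.IsWellTempered) :
    (G + H).IsWellTempered := by
  obtain ⟨p, hp⟩ := isWellTempered_iff.1 hG
  obtain ⟨q, hq⟩ := isWellTempered_iff.1 hH
  exact (hp.add hq).isWellTempered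

theorem IsWellTempered.neg {G : ScoringGame} (hG : G.IsWellTempered) : (-G).IsWellTempered := by
  obtain ⟨p, hp⟩ := isWellTempered_iff.1 hG
  exact hp.neg.isWellTempered

theorem outcomes_neg {p : Bool} {G : ScoringGame} (hG : Tempered p G) :
    (-G).leftOutcome = -G.rightOutcome ∧ (-G).rightOutcome = -G.leftOutcome := by
  induction G using option_induction generalizing p with
  | _ G ihl ihr =>
  rcases hG.isInt_or with ⟨rfl, ⟨n, rfl⟩⟩ | ⟨hl, hr⟩
  · simp [neg_int]
  · have hnl : (-G).left.Nonempty := by rw [left_neg]; exact hr.image _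
    have hnr : (-G).right.Nonempty := by rw [right_neg]; exact hl.image _
    constructor
    · apply le_antisymm
      · refine leftOutcome_le hnl fun K hK => ?_
        have hK' := mem_left_neg.1 hK
        have := (ihr _ hK' (hG.of_mem_right hK')).2
        rw [neg_neg] at this
        rw [this, neg_le_neg_iff]
        exact rightOutcome_le_of_mem_right hK'
      · obtain ⟨K, hK, e⟩ := exists_rightOutcome_eq hr
        rw [e, ← (ihr _ hK (hG.of_mem_right hK)).2]
        exact rightOutcome_le_of_mem_left (neg_mem_left_neg.2 hK)
    · apply le_antisymm
      · obtain ⟨K, hK, e⟩ := exists_leftOutcome_eq hl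
        rw [e, ← (ihl _ hK (hG.of_mem_left hK)).1]
        exact rightOutcome_le_of_mem_right (neg_mem_right_neg.2 hK)
      · refine le_rightOutcome hnr fun K hK => ?_
        have hK' := mem_right_neg.1 hK
        have := (ihl _ hK' (hG.of_mem_left hK')).1
        rw [neg_neg] at this
        rw [this, neg_le_neg_iff]
        exact rightOutcome_le_of_mem_left hK'

theorem leftOutcome_neg {G : ScoringGame} (hG : G.IsWellTempered) :
    (-G).leftOutcome = -G.rightOutcome :=
  (isWellTempered_iff.1 hG).elim fun _ h => (outcomes_neg h).1

theorem rightOutcome_neg {G : ScoringGame} (hG : G.IsWellTempered) :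
    (-G).rightOutcome = -G.leftOutcome :=
  (isWellTempered_iff.1 hG).elim fun _ h => (outcomes_neg h).2

theorem outcomes_int_add {p : Bool} {G : ScoringGame} (hG : Tempered p G) (n : ℤ) :
    (int n + G).leftOutcome = n + G.leftOutcome ∧
      (int n + G).rightOutcome = n + G.rightOutcome := by
  induction G using option_induction generalizing p with
  | _ G ihl ihr =>
  rcases hG.isInt_or with ⟨rfl, ⟨m, rfl⟩⟩ | ⟨hl, hr⟩
  · simp [int_add_int]
  · constructor
    · obtain ⟨K, hK, e⟩ := exists_leftOutcome_eq hl
      apply le_antisymm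
      · refine leftOutcome_le ⟨_, add_mem_left_of_right hK _⟩ fun J hJ => ?_
        rcases mem_left_add.1 hJ with ⟨A, hA, rfl⟩ | ⟨B, hB, rfl⟩
        · simp at hA
        · rw [(ihl B hB (hG.of_mem_left hB)).2]
          exact add_le_add_right (rightOutcome_le_of_mem_left hB) _
      · rw [e, ← (ihl K hK (hG.of_mem_left hK)).2]
        exact rightOutcome_le_of_mem_left (add_mem_left_of_right hK _)
    · obtain ⟨K, hK, e⟩ := exists_rightOutcome_eq hr
      apply le_antisymm
      · rw [e, ← (ihr K hK (hG.of_mem_right hK)).1]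
        exact rightOutcome_le_of_mem_right (add_mem_right_of_right hK _)
      · refine le_rightOutcome ⟨_, add_mem_right_of_right hK _⟩ fun J hJ => ?_
        rcases mem_right_add.1 hJ with ⟨A, hA, rfl⟩ | ⟨B, hB, rfl⟩
        · simp at hA
        · rw [(ihr B hB (hG.of_mem_right hB)).1]
          exact add_le_add_right (rightOutcome_le_of_mem_right hB) _

/-! ### The class of games with even gap zero -/

theorem IsWellTempered.exists_isSubgame_int {G : ScoringGame} (hG : G.IsWellTempered) :
    ∃ n, IsSubgame (int n) G := by
  obtain ⟨p, hp⟩ := isWellTempered_iff.1 hG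
  clear hG
  induction G using option_induction generalizing p with
  | _ G ihl ihr =>
  rcases hp.isInt_or with ⟨-, n, rfl⟩ | ⟨⟨K, hK⟩, -⟩
  · exact ⟨n, IsSubgame.refl⟩
  · obtain ⟨n, hn⟩ := ihl K hK _ (hp.of_mem_left hK)
    exact ⟨n, IsSubgame.left hK hn⟩

/-- Every well-tempered game has an integer subgame, which contributes `0` to the supremum; so the
gap is never negative and only the upper bound carries information. -/
theorem mem_classI_iff_forall {G : ScoringGame} :
    G ∈ classI ↔ G.IsWellTempered ∧
      ∀ H, IsSubgame H G → Tempered false H → H.rightOutcome ≤ H.leftOutcome := by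
  refine and_congr_right fun hG => ?_
  constructor
  · intro h H hH he
    have h1 : (((H.rightOutcome - H.leftOutcome : ℤ) : ℝ) : EReal) ≤ G.evenGap :=
      le_iSup_of_le H (le_iSup_of_le hH (le_iSup_of_le he le_rfl))
    rw [h, ← EReal.coe_zero, EReal.coe_le_coe_iff] at h1
    have h2 : H.rightOutcome - H.leftOutcome ≤ 0 := by exact_mod_cast h1
    linarith
  · intro h
    apply le_antisymm
    · refine iSup_le fun H => iSup_le fun hH => iSup_le fun he => ?_
      rw [← EReal.coe_zero, EReal.coe_le_coe_iff]
      have := h H hH he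
      exact_mod_cast sub_nonpos.2 this
    · obtain ⟨n, hn⟩ := hG.exists_isSubgame_int
      refine le_iSup_of_le (int n) (le_iSup_of_le hn (le_iSup_of_le (tempered_int n) ?_))
      simp

theorem mem_classI_int (n : ℤ) : int n ∈ classI := by
  refine mem_classI_iff_forall.2 ⟨(tempered_int n).isWellTempered, fun H hH _ => ?_⟩
  cases hH with
  | refl => simp
  | left hK => simp at hK
  | right hK => simp at hK

theorem isWellTempered_of_mem_classI {G : ScoringGame} (hG : G ∈ classI) : G.IsWellTempered :=
  hG.1

theorem mem_classI_of_mem_left {G K : ScoringGame} (hG : G ∈ classI) (hK : K ∈ G.left) :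
    K ∈ classI := by
  obtain ⟨h1, h2⟩ := mem_classI_iff_forall.1 hG
  obtain ⟨p, hp⟩ := isWellTempered_iff.1 h1
  exact mem_classI_iff_forall.2
    ⟨(hp.of_mem_left hK).isWellTempered, fun H hH => h2 H (hH.left hK)⟩

theorem mem_classI_of_mem_right {G K : ScoringGame} (hG : G ∈ classI) (hK : K ∈ G.right) :
    K ∈ classI := by
  obtain ⟨h1, h2⟩ := mem_classI_iff_forall.1 hG
  obtain ⟨p, hp⟩ := isWellTempered_iff.1 h1
  exact mem_classI_iff_forall.2
    ⟨(hp.of_mem_right hK).isWellTempered, fun H hH => h2 H (hH.right hK)⟩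

theorem rightOutcome_le_leftOutcome_of_mem_classI {G : ScoringGame} (hG : G ∈ classI)
    (he : Tempered false G) : G.rightOutcome ≤ G.leftOutcome :=
  (mem_classI_iff_forall.1 hG).2 G IsSubgame.refl he

theorem mem_classI_of_options {p : Bool} {G : ScoringGame} (hG : Tempered p G)
    (ho : p = false → G.rightOutcome ≤ G.leftOutcome) (hl : ∀ K ∈ G.left, K ∈ classI)
    (hr : ∀ K ∈ G.right, K ∈ classI) : G ∈ classI := by
  refine mem_classI_iff_forall.2 ⟨hG.isWellTempered, fun H hH he => ?_⟩
  cases hH with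
  | refl => exact ho (hG.unique he)
  | left hK h => exact (mem_classI_iff_forall.1 (hl _ hK)).2 H h he
  | right hK h => exact (mem_classI_iff_forall.1 (hr _ hK)).2 H h he

theorem mem_classI_neg {G : ScoringGame} (hG : G ∈ classI) : -G ∈ classI := by
  induction G using option_induction with
  | _ G ihl ihr =>
  have hw := isWellTempered_of_mem_classI hG
  obtain ⟨p, hp⟩ := isWellTempered_iff.1 hw
  refine mem_classI_of_options hp.neg ?_ ?_ ?_
  · rintro rfl
    rw [leftOutcome_neg hw, rightOutcome_neg hw, neg_le_neg_iff]
    exact rightOutcome_le_leftOutcome_of_mem_classI hG hp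
  · intro K hK
    have hK' := mem_left_neg.1 hK
    simpa using ihr _ hK' (mem_classI_of_mem_right hG hK')
  · intro K hK
    have hK' := mem_right_neg.1 hK
    simpa using ihl _ hK' (mem_classI_of_mem_left hG hK')

-- Outcomes of sums of games with even gap zero.

/-- Left opens in the component whose left outcome is counted, then replies to Right. The three
bounds need a joint induction: a move by Left leads to the bound on `R(G + H)`, and a move by Right
leads back to one of the two bounds on `L(G + H)`. -/
theorem outcomes_add_ge_of_mem_classI {p : Bool} {G H : ScoringGame} (hG : G ∈ classI)
    (hH : H ∈ classI) (hp : Tempered p G) :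
    (Tempered false H → G.leftOutcome + H.rightOutcome ≤ (G + H).leftOutcome ∧
      G.rightOutcome + H.rightOutcome ≤ (G + H).rightOutcome) ∧
    (p = true → Tempered true H → G.rightOutcome + H.leftOutcome ≤ (G + H).leftOutcome) := by
  induction hn : G.height + H.height using Nat.strong_induction_on generalizing G H p with
  | _ n ih =>
  subst hn
  refine ⟨fun hq => ⟨?_, ?_⟩, ?_⟩
  · rcases hp.isInt_or with ⟨rfl, ⟨m, rfl⟩⟩ | ⟨hl, hr⟩
    -- Left cannot open in an integer and has to open `H`; this is where the gap condition itself,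
    -- not just its inheritance by options, is used.
    · rw [(outcomes_int_add hq m).1, leftOutcome_int]
      exact add_le_add_right (rightOutcome_le_leftOutcome_of_mem_classI hH hq) _
    · obtain ⟨K, hK, e⟩ := exists_leftOutcome_eq hl
      rw [e]
      refine le_trans ?_ (rightOutcome_le_of_mem_left (add_mem_left_of_left hK H))
      exact ((ih _ (Nat.add_lt_add_right (height_lt_of_mem_left hK) _)
        (mem_classI_of_mem_left hG hK) hH (hp.of_mem_left hK) rfl).1 hq).2
  · by_cases h : G.IsInt ∧ H.IsInt
    · obtain ⟨⟨m, rfl⟩, ⟨n, rfl⟩⟩ := h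
      simp [int_add_int]
    · have hne : (G + H).right.Nonempty := by
        rcases (hp.add hq).isInt_or with ⟨-, hi⟩ | ⟨-, h⟩
        · exact absurd (isInt_add_iff.1 hi) h
        · exact h
      refine le_rightOutcome hne fun K hK => ?_
      rcases mem_right_add.1 hK with ⟨A, hA, rfl⟩ | ⟨B, hB, rfl⟩
      · refine le_trans (add_le_add_left (rightOutcome_le_of_mem_right hA) _) ?_
        exact ((ih _ (Nat.add_lt_add_right (height_lt_of_mem_right hA) _)
          (mem_classI_of_mem_right hG hA) hH (hp.of_mem_right hA) rfl).1 hq).1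
      · refine le_trans (add_le_add_right (rightOutcome_le_of_mem_right hB) _) ?_
        have hlt : G.height + B.height < G.height + H.height :=
          Nat.add_lt_add_left (height_lt_of_mem_right hB) _
        have hB' := mem_classI_of_mem_right hH hB
        cases p with
        | false =>
          rw [add_comm, add_comm G B]
          exact ((ih _ (by rwa [add_comm B.height]) hB' hG (hq.of_mem_right hB) rfl).1 hp).1
        | true => exact (ih _ hlt hG hB' hp rfl).2 rfl (hq.of_mem_right hB)
  · rintro rfl hq
    obtain ⟨K, hK, e⟩ := exists_leftOutcome_eq hq.nonempty_of_true.1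
    rw [e]
    refine le_trans ?_ (rightOutcome_le_of_mem_left (add_mem_left_of_right hK G))
    exact ((ih _ (Nat.add_lt_add_left (height_lt_of_mem_left hK) _) hG
      (mem_classI_of_mem_left hH hK) hp rfl).1 (hq.of_mem_left hK)).2

theorem rightOutcome_add_le_of_odd {G H : ScoringGame} (hG : G ∈ classI)
    (hH : H ∈ classI) (hp : Tempered true G) (hq : Tempered true H) :
    (G + H).rightOutcome ≤ G.leftOutcome + H.rightOutcome := by
  have := (outcomes_add_ge_of_mem_classI (mem_classI_neg hG) (mem_classI_neg hH) hp.neg).2 rfl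
    hq.neg
  rw [← game_neg_add, leftOutcome_neg (hp.add hq).isWellTempered, leftOutcome_neg hH.1,
    rightOutcome_neg hG.1] at this
  linarith

theorem rightOutcome_add_le_of_even {G H : ScoringGame} (hG : G ∈ classI)
    (hH : H ∈ classI) (hp : Tempered false G) (hq : Tempered false H) :
    (G + H).rightOutcome ≤ G.rightOutcome + H.leftOutcome := by
  have := ((outcomes_add_ge_of_mem_classI (mem_classI_neg hG) (mem_classI_neg hH) hp.neg).1
    hq.neg).1
  rw [← game_neg_add, leftOutcome_neg (hp.add hq).isWellTempered, rightOutcome_neg hH.1,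
    leftOutcome_neg hG.1] at this
  linarith

/-- When the sum is even-tempered, a single number separates its outcomes: `R(G) + L(H)` if both
summands are even-tempered, `L(G) + R(H)` if both are odd-tempered. -/
theorem mem_classI_add {G H : ScoringGame} (hG : G ∈ classI) (hH : H ∈ classI) :
    G + H ∈ classI := by
  induction G using option_induction generalizing H with
  | _ G ihl ihr =>
  induction H using option_induction with
  | _ H jhl jhr =>
  obtain ⟨p, hp⟩ := isWellTempered_iff.1 hG.1
  obtain ⟨q, hq⟩ := isWellTempered_iff.1 hH.1
  refine mem_classI_of_options (hp.add hq) ?_ ?_ ?_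
  · intro hpq
    have h1 := outcomes_add_ge_of_mem_classI hG hH hp
    cases p <;> cases q
    · refine (rightOutcome_add_le_of_even hG hH hp hq).trans ?_
      have h2 := ((outcomes_add_ge_of_mem_classI hH hG hq).1 hp).1
      rw [add_comm H G] at h2
      linarith
    · simp at hpq
    · simp at hpq
    · refine (rightOutcome_add_le_of_odd hG hH hp hq).trans ?_
      have h2 := (outcomes_add_ge_of_mem_classI hH hG hq).2 rfl hp
      rw [add_comm H G] at h2
      linarith
  · intro K hK
    rcases mem_left_add.1 hK with ⟨A, hA, rfl⟩ | ⟨B, hB, rfl⟩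
    · exact ihl A hA (mem_classI_of_mem_left hG hA) hH
    · exact jhl B hB (mem_classI_of_mem_left hH hB)
  · intro K hK
    rcases mem_right_add.1 hK with ⟨A, hA, rfl⟩ | ⟨B, hB, rfl⟩
    · exact ihr A hA (mem_classI_of_mem_right hG hA) hH
    · exact jhr B hB (mem_classI_of_mem_right hH hB)

/-- Left follows an optimal line in `X` and answers each move of Right in `K` by a move in `K` that
restores a right outcome of at least `c`. Here `X` need not lie in `classI`. -/
theorem outcomes_add_ge_of_le_rightOutcome {K X : ScoringGame} {c : ℤ} (hK : K ∈ classI)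
    (he : Tempered false K) (hc : c ≤ K.rightOutcome) (hX : X.IsWellTempered) :
    c + X.leftOutcome ≤ (K + X).leftOutcome ∧ c + X.rightOutcome ≤ (K + X).rightOutcome := by
  obtain ⟨q, hq⟩ := isWellTempered_iff.1 hX
  clear hX
  induction hn : K.height using Nat.strong_induction_on generalizing K X q with
  | _ n ih =>
  subst hn
  induction X using option_induction generalizing q with
  | _ X jhl jhr =>
  by_cases hi : X.IsInt
  · obtain ⟨m, rfl⟩ := hi
    rw [add_comm K, (outcomes_int_add he m).1, (outcomes_int_add he m).2, leftOutcome_int,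
      rightOutcome_int]
    -- Once `X` is over, Left may be the one to open `K`; even gap zero makes this harmless.
    have := rightOutcome_le_leftOutcome_of_mem_classI hK he
    constructor <;> linarith
  · obtain ⟨hl, hr⟩ := hq.isInt_or.resolve_left fun h => hi h.2
    constructor
    · obtain ⟨A, hA, e⟩ := exists_leftOutcome_eq hl
      rw [e]
      exact (jhl A hA _ (hq.of_mem_left hA)).2.trans
        (rightOutcome_le_of_mem_left (add_mem_left_of_right hA K))
    · obtain ⟨C, hC⟩ := hr
      refine le_rightOutcome ⟨_, add_mem_right_of_right hC K⟩ fun J hJ => ?_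
      rcases mem_right_add.1 hJ with ⟨A, hA, rfl⟩ | ⟨B, hB, rfl⟩
      · have hAo := he.of_mem_right hA
        obtain ⟨A', hA', e⟩ := exists_leftOutcome_eq hAo.nonempty_of_true.1
        have h1 := rightOutcome_le_of_mem_right hA
        refine le_trans ?_ (rightOutcome_le_of_mem_left (add_mem_left_of_left hA' X))
        exact (ih _ ((height_lt_of_mem_left hA').trans (height_lt_of_mem_right hA))
          (mem_classI_of_mem_left (mem_classI_of_mem_right hK hA) hA') (hAo.of_mem_left hA')
          (by linarith) _ hq rfl).2
      · exact (add_le_add_right (rightOutcome_le_of_mem_right hB) _).trans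
          (jhr B hB _ (hq.of_mem_right hB)).1

theorem outcomes_add_le_of_leftOutcome_le {K X : ScoringGame} {c : ℤ} (hK : K ∈ classI)
    (he : Tempered false K) (hc : K.leftOutcome ≤ c) (hX : X.IsWellTempered) :
    (K + X).leftOutcome ≤ c + X.leftOutcome ∧ (K + X).rightOutcome ≤ c + X.rightOutcome := by
  have h := outcomes_add_ge_of_le_rightOutcome (c := -c) (mem_classI_neg hK) he.neg
    (by rw [rightOutcome_neg hK.1]; exact neg_le_neg hc) hX.neg
  rw [← game_neg_add, leftOutcome_neg (hK.1.add hX), rightOutcome_neg (hK.1.add hX),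
    leftOutcome_neg hX, rightOutcome_neg hX] at h
  constructor <;> linarith [h.1, h.2]

/-- Left mirrors each move of Right in the other component. No gap condition is needed for this half
of `G + -G ≈ 0`. -/
theorem rightOutcome_add_neg_self_nonneg {G : ScoringGame} (hG : G.IsWellTempered) :
    0 ≤ (G + -G).rightOutcome := by
  obtain ⟨p, hp⟩ := isWellTempered_iff.1 hG
  clear hG
  induction G using option_induction generalizing p with
  | _ G ihl ihr =>
  rcases hp.isInt_or with ⟨-, ⟨m, rfl⟩⟩ | ⟨hl, ⟨C, hC⟩⟩
  · simp [neg_int, int_add_int]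
  · refine le_rightOutcome ⟨_, add_mem_right_of_left hC _⟩ fun J hJ => ?_
    rcases mem_right_add.1 hJ with ⟨A, hA, rfl⟩ | ⟨B, hB, rfl⟩
    · exact (ihr A hA _ (hp.of_mem_right hA)).trans
        (rightOutcome_le_of_mem_left (add_mem_left_of_right (neg_mem_left_neg.2 hA) A))
    · have hB' := mem_right_neg.1 hB
      have := ihl _ hB' _ (hp.of_mem_left hB')
      rw [neg_neg] at this
      exact this.trans (rightOutcome_le_of_mem_left (add_mem_left_of_left hB' B))

/-! ### The order -/

theorem Ge.refl (G : ScoringGame) : Ge G G := fun _ _ => ⟨le_rfl, le_rfl⟩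

theorem Ge.trans {G H K : ScoringGame} (h1 : Ge G H) (h2 : Ge H K) : Ge G K := fun X hX =>
  ⟨(h2 X hX).1.trans (h1 X hX).1, (h2 X hX).2.trans (h1 X hX).2⟩

theorem equivalent_iff_ge {G H : ScoringGame} : Equivalent G H ↔ Ge G H ∧ Ge H G :=
  ⟨fun h => ⟨fun X hX => ⟨(h X hX).1.ge, (h X hX).2.ge⟩, fun X hX => ⟨(h X hX).1.le, (h X hX).2.le⟩⟩,
    fun h X hX => ⟨le_antisymm (h.2 X hX).1 (h.1 X hX).1, le_antisymm (h.2 X hX).2 (h.1 X hX).2⟩⟩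

theorem Equivalent.symm {G H : ScoringGame} (h : Equivalent G H) : Equivalent H G :=
  equivalent_iff_ge.2 (equivalent_iff_ge.1 h).symm

theorem Equivalent.trans {G H K : ScoringGame} (h1 : Equivalent G H) (h2 : Equivalent H K) :
    Equivalent G K := fun X hX =>
  ⟨(h1 X hX).1.trans (h2 X hX).1, (h1 X hX).2.trans (h2 X hX).2⟩

theorem Ge.add_right {G H : ScoringGame} (h : Ge G H) {Y : ScoringGame} (hY : Y.IsWellTempered) :
    Ge (G + Y) (H + Y) := fun X hX => by
  rw [add_assoc, add_assoc]
  exact h _ (hY.add hX)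

theorem Ge.leftOutcome_le {G H : ScoringGame} (h : Ge G H) : H.leftOutcome ≤ G.leftOutcome := by
  simpa only [← zero_def, add_zero] using (h (int 0) (tempered_int 0).isWellTempered).1

theorem Ge.rightOutcome_le {G H : ScoringGame} (h : Ge G H) : H.rightOutcome ≤ G.rightOutcome := by
  simpa only [← zero_def, add_zero] using (h (int 0) (tempered_int 0).isWellTempered).2

theorem Ge.neg {G H : ScoringGame} (hG : G.IsWellTempered) (hH : H.IsWellTempered)
    (h : Ge G H) : Ge (-H) (-G) := fun X hX => by
  have e : ∀ K : ScoringGame, -K + X = -(K + -X) := fun K => by rw [game_neg_add, neg_neg]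
  rw [e, e, leftOutcome_neg (hG.add hX.neg), leftOutcome_neg (hH.add hX.neg),
    rightOutcome_neg (hG.add hX.neg), rightOutcome_neg (hH.add hX.neg)]
  exact ⟨neg_le_neg (h _ hX.neg).2, neg_le_neg (h _ hX.neg).1⟩

theorem ge_neg_iff {G H : ScoringGame} (hG : G.IsWellTempered) (hH : H.IsWellTempered) :
    Ge (-H) (-G) ↔ Ge G H :=
  ⟨fun h => by simpa only [neg_neg] using h.neg hH.neg hG.neg, fun h => h.neg hG hH⟩

theorem Equivalent.neg {G H : ScoringGame} (hG : G.IsWellTempered) (hH : H.IsWellTempered)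
    (h : Equivalent G H) : Equivalent (-G) (-H) :=
  equivalent_iff_ge.2 ⟨(equivalent_iff_ge.1 h).2.neg hH hG, (equivalent_iff_ge.1 h).1.neg hG hH⟩

theorem ge_zero_of_rightOutcome_nonneg {K : ScoringGame} (hK : K ∈ classI)
    (he : Tempered false K) (h : 0 ≤ K.rightOutcome) : Ge K 0 := fun X hX => by
  simpa using outcomes_add_ge_of_le_rightOutcome hK he h hX

theorem zero_ge_of_leftOutcome_nonpos {K : ScoringGame} (hK : K ∈ classI)
    (he : Tempered false K) (h : K.leftOutcome ≤ 0) : Ge 0 K := fun X hX => by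
  simpa using outcomes_add_le_of_leftOutcome_le hK he h hX

theorem Tempered.add_neg {p : Bool} {G H : ScoringGame} (hG : Tempered p G) (hH : Tempered p H) :
    Tempered false (G + -H) := by
  simpa using hG.add hH.neg

theorem equivalent_add_neg_self {G : ScoringGame} (hG : G ∈ classI) : Equivalent (G + -G) 0 := by
  obtain ⟨p, hp⟩ := isWellTempered_iff.1 hG.1
  have h1 := rightOutcome_add_neg_self_nonneg hG.1
  have hm := mem_classI_add hG (mem_classI_neg hG)
  refine equivalent_iff_ge.2 ⟨ge_zero_of_rightOutcome_nonneg hm (hp.add_neg hp) h1,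
    zero_ge_of_leftOutcome_nonpos hm (hp.add_neg hp) ?_⟩
  have e : G + -G = -(G + -G) := by rw [game_neg_add, neg_neg, add_comm]
  rw [e, leftOutcome_neg (hG.1.add hG.1.neg)]
  linarith

-- Comparing games with even gap zero by their moves.

/-- Forwards, add `-H` and mirror. Backwards, `G + -H` is even-tempered in `classI`, hence `≳ 0`;
add `H` and cancel `H + -H`. -/
theorem ge_iff_rightOutcome_nonneg {p : Bool} {G H : ScoringGame} (hG : G ∈ classI)
    (hH : H ∈ classI) (hp : Tempered p G) (hq : Tempered p H) :
    Ge G H ↔ 0 ≤ (G + -H).rightOutcome := by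
  constructor
  · intro h
    exact (rightOutcome_add_neg_self_nonneg hH.1).trans (h _ hH.1.neg).2
  · intro h
    have h1 := (ge_zero_of_rightOutcome_nonneg (mem_classI_add hG (mem_classI_neg hH))
      (hp.add_neg hq) h).add_right hH.1
    have h2 := (equivalent_iff_ge.1 (equivalent_add_neg_self hH)).2.add_right hG.1
    rw [zero_add] at h1 h2
    have e : G + -H + H = H + -H + G := by rw [add_assoc, add_comm (-H), add_comm]
    rw [e] at h1
    exact h2.trans h1

/-- After Right opens `G + -H` by moving to `A + -H`, Left has a reply keeping the right outcome
nonnegative; the two cases are a reply in `-H` and a reply in `A`. -/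
theorem Ge.right_move {p : Bool} {G H A : ScoringGame} (h : Ge G H) (hG : G ∈ classI)
    (hH : H ∈ classI) (hp : Tempered p G) (hq : Tempered p H) (hA : A ∈ G.right) :
    (∃ B ∈ H.right, Ge A B) ∨ ∃ A' ∈ A.left, Ge A' H := by
  have h0 := ((ge_iff_rightOutcome_nonneg hG hH hp hq).1 h).trans
    (rightOutcome_le_of_mem_right (add_mem_right_of_left hA (-H)))
  have hA' := mem_classI_of_mem_right hG hA
  have hAt := hp.of_mem_right hA
  have ho : Tempered true (A + -H) := by simpa using hAt.add hq.neg
  obtain ⟨K, hK, e⟩ := exists_leftOutcome_eq ho.nonempty_of_true.1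
  rw [e] at h0
  rcases mem_left_add.1 hK with ⟨C, hC, rfl⟩ | ⟨B, hB, rfl⟩
  · exact Or.inr ⟨C, hC, (ge_iff_rightOutcome_nonneg (mem_classI_of_mem_left hA' hC) hH
      (by simpa using hAt.of_mem_left hC) hq).2 h0⟩
  · have hB' := mem_left_neg.1 hB
    exact Or.inl ⟨-B, hB', (ge_iff_rightOutcome_nonneg hA' (mem_classI_of_mem_right hH hB') hAt
      (hq.of_mem_right hB')).2 (by rwa [neg_neg])⟩

theorem Ge.left_move {p : Bool} {G H B : ScoringGame} (h : Ge G H) (hG : G ∈ classI)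
    (hH : H ∈ classI) (hp : Tempered p G) (hq : Tempered p H) (hB : B ∈ H.left) :
    (∃ A ∈ G.left, Ge A B) ∨ ∃ B' ∈ B.right, Ge G B' := by
  have hBt := hq.of_mem_left hB
  rcases (h.neg hG.1 hH.1).right_move (mem_classI_neg hH) (mem_classI_neg hG) hq.neg hp.neg
    (neg_mem_right_neg.2 hB) with ⟨C, hC, hge⟩ | ⟨C, hC, hge⟩
  · have hC' := mem_right_neg.1 hC
    exact Or.inl ⟨-C, hC', (ge_neg_iff (hp.of_mem_left hC').isWellTempered
      hBt.isWellTempered).1 (by rwa [neg_neg])⟩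
  · have hC' := mem_left_neg.1 hC
    exact Or.inr ⟨-C, hC', (ge_neg_iff hG.1 (hBt.of_mem_right hC').isWellTempered).1
      (by rwa [neg_neg])⟩

/-- The move conditions supply Left's reply to every opening of Right in `G + -H`. If Right has no
opening, as for two integers, they hold vacuously and prove nothing; `hne` excludes this. -/
theorem ge_of_moves {p : Bool} {G H : ScoringGame} (hG : G ∈ classI)
    (hH : H ∈ classI) (hp : Tempered p G) (hq : Tempered p H)
    (hne : G.right.Nonempty ∨ H.left.Nonempty)
    (hr : ∀ A ∈ G.right, (∃ B ∈ H.right, Ge A B) ∨ ∃ A' ∈ A.left, Ge A' H)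
    (hl : ∀ B ∈ H.left, (∃ A ∈ G.left, Ge A B) ∨ ∃ B' ∈ B.right, Ge G B') : Ge G H := by
  refine (ge_iff_rightOutcome_nonneg hG hH hp hq).2 ?_
  have hne' : (G + -H).right.Nonempty := by
    rcases hne with ⟨A, hA⟩ | ⟨B, hB⟩
    · exact ⟨_, add_mem_right_of_left hA _⟩
    · exact ⟨_, add_mem_right_of_right (neg_mem_right_neg.2 hB) _⟩
  refine le_rightOutcome hne' fun J hJ => ?_
  rcases mem_right_add.1 hJ with ⟨A, hA, rfl⟩ | ⟨C, hC, rfl⟩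
  · have hA' := mem_classI_of_mem_right hG hA
    have hAt := hp.of_mem_right hA
    rcases hr A hA with ⟨B, hB, h⟩ | ⟨A', hA2, h⟩
    · exact ((ge_iff_rightOutcome_nonneg hA' (mem_classI_of_mem_right hH hB) hAt
        (hq.of_mem_right hB)).1 h).trans
        (rightOutcome_le_of_mem_left (add_mem_left_of_right (neg_mem_left_neg.2 hB) A))
    · exact ((ge_iff_rightOutcome_nonneg (mem_classI_of_mem_left hA' hA2) hH
        (by simpa using hAt.of_mem_left hA2) hq).1 h).trans
        (rightOutcome_le_of_mem_left (add_mem_left_of_left hA2 _))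
  · obtain ⟨B, rfl⟩ : ∃ B, C = -B := ⟨-C, (neg_neg C).symm⟩
    have hB := neg_mem_right_neg.1 hC
    have hB' := mem_classI_of_mem_left hH hB
    have hBt := hq.of_mem_left hB
    rcases hl B hB with ⟨A, hA, h⟩ | ⟨B', hB2, h⟩
    · exact ((ge_iff_rightOutcome_nonneg (mem_classI_of_mem_left hG hA) hB' (hp.of_mem_left hA)
        hBt).1 h).trans (rightOutcome_le_of_mem_left (add_mem_left_of_left hA _))
    · exact ((ge_iff_rightOutcome_nonneg hG (mem_classI_of_mem_right hB' hB2) hp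
        (by simpa using hBt.of_mem_right hB2)).1 h).trans
        (rightOutcome_le_of_mem_left (add_mem_left_of_right (neg_mem_left_neg.2 hB2) G))

/-! ### Equivalent games have the same parity -/

/-- An odd-tempered game in which the player who moves loses `2 N` points. -/
noncomputable def cold (N : ℤ) : ScoringGame := node {int (-N)} {int N}

theorem tempered_cold (N : ℤ) : Tempered true (cold N) := by
  refine tempered_of_options ?_ ?_ ?_ ?_ <;> simp [cold, tempered_int]

theorem rightOutcome_cold (N : ℤ) : (cold N).rightOutcome = N := by
  obtain ⟨K, hK, e⟩ := exists_rightOutcome_eq (tempered_cold N).nonempty_of_true.2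
  simp only [cold, right_node, Finset.mem_singleton] at hK
  rw [e, hK, leftOutcome_int]

theorem neg_cold (N : ℤ) : -cold N = cold N := by
  simp [cold, neg_node, neg_int]

/-- Left leaves the cold component alone. By parity, Right is the one who must eventually move there
and pay `N`, while play in `G` costs an amount independent of `N`. -/
theorem Tempered.exists_le_outcome_add_cold {p : Bool} {G : ScoringGame} (hp : Tempered p G) :
    ∃ M : ℤ, ∀ N : ℤ, (p = false → N - M ≤ (G + cold N).rightOutcome) ∧
      (p = true → N - M ≤ (G + cold N).leftOutcome) := by
  induction G using option_induction generalizing p with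
  | _ G ihl ihr =>
  cases p with
  | false =>
    rcases hp.isInt_or with ⟨-, m, rfl⟩ | ⟨-, C, hC⟩
    · refine ⟨-m, fun N => ⟨fun _ => ?_, fun h => by simp at h⟩⟩
      rw [(outcomes_int_add (tempered_cold N) m).2, rightOutcome_cold]
      linarith
    · have h : ∀ K : ScoringGame, ∃ M : ℤ, K ∈ G.right → ∀ N : ℤ,
          N - M ≤ (K + cold N).leftOutcome := by
        intro K
        by_cases hK : K ∈ G.right
        · obtain ⟨M, hM⟩ := ihr K hK (hp.of_mem_right hK)
          exact ⟨M, fun _ N => (hM N).2 rfl⟩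
        · exact ⟨0, fun h => absurd h hK⟩
      choose f hf using h
      obtain ⟨M, hM⟩ := Finset.exists_le (G.right.image f)
      -- `M` covers Right's moves in `G`; `-G.leftOutcome` covers an immediate move to `int N`,
      -- which leaves Left to open `G`.
      refine ⟨max M (-G.leftOutcome), fun N => ⟨fun _ => ?_, fun h => by simp at h⟩⟩
      refine le_rightOutcome ⟨_, add_mem_right_of_left hC _⟩ fun J hJ => ?_
      rcases mem_right_add.1 hJ with ⟨A, hA, rfl⟩ | ⟨B, hB, rfl⟩
      · have h1 := hf A hA N
        have h2 := hM _ (Finset.mem_image_of_mem f hA)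
        have h3 := le_max_left M (-G.leftOutcome)
        linarith
      · simp only [cold, right_node, Finset.mem_singleton] at hB
        rw [hB, add_comm, (outcomes_int_add hp N).1]
        have h3 := le_max_right M (-G.leftOutcome)
        linarith
  | true =>
    obtain ⟨A, hA⟩ := hp.nonempty_of_true.1
    obtain ⟨M, hM⟩ := ihl A hA (hp.of_mem_left hA)
    exact ⟨M, fun N => ⟨fun h => by simp at h, fun _ => ((hM N).1 rfl).trans
      (rightOutcome_le_of_mem_left (add_mem_left_of_left hA _))⟩⟩

theorem not_equivalent_of_even_of_odd {G H : ScoringGame} (hG : Tempered false G)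
    (hH : Tempered true H) : ¬ Equivalent G H := by
  intro h
  obtain ⟨M, hM⟩ := hG.neg.exists_le_outcome_add_cold
  obtain ⟨M', hM'⟩ := hH.exists_le_outcome_add_cold
  -- With `N` the chosen temperature, the two bounds on a common left outcome give `N - M' ≤ M - N`;
  -- this `N` makes `2 N > M + M'`.
  have h1 := (hM (|M| + |M'| + 1)).1 rfl
  have h2 := (hM' (|M| + |M'| + 1)).2 rfl
  have hc := tempered_cold (|M| + |M'| + 1)
  rw [← neg_cold, ← game_neg_add, rightOutcome_neg (hG.add hc).isWellTempered] at h1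
  rw [← (h _ hc.isWellTempered).1] at h2
  linarith [le_abs_self M, le_abs_self M', abs_nonneg M, abs_nonneg M']

theorem Equivalent.parity_eq {p q : Bool} {G H : ScoringGame} (h : Equivalent G H)
    (hG : Tempered p G) (hH : Tempered q H) : p = q := by
  cases p <;> cases q
  · rfl
  · exact absurd h (not_equivalent_of_even_of_odd hG hH)
  · exact absurd h.symm (not_equivalent_of_even_of_odd hH hG)
  · rfl

/-! ### Invertible games are equivalent to games with even gap zero -/

/-- For games of parity `p`: Left does at least as well with `H` as with `G` in every sum in which
Left makes the last move. -/
def UpLe (p : Bool) (G H : ScoringGame) : Prop :=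
  ∀ q X, Tempered q X →
    ((p ^^ q) = false → (G + X).rightOutcome ≤ (H + X).rightOutcome) ∧
    ((p ^^ q) = true → (G + X).leftOutcome ≤ (H + X).leftOutcome)

theorem UpLe.trans {p : Bool} {G H K : ScoringGame} (h1 : UpLe p G H) (h2 : UpLe p H K) :
    UpLe p G K := fun q X hX =>
  ⟨fun h => ((h1 q X hX).1 h).trans ((h2 q X hX).1 h),
    fun h => ((h1 q X hX).2 h).trans ((h2 q X hX).2 h)⟩

theorem UpLe.add_right {p q : Bool} {G H Y : ScoringGame} (h : UpLe p G H) (hY : Tempered q Y) :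
    UpLe (p ^^ q) (G + Y) (H + Y) := fun r X hX => by
  rw [add_assoc, add_assoc, Bool.xor_assoc]
  exact h _ _ (hY.add hX)

theorem UpLe.add {p q : Bool} {G H G' H' : ScoringGame} (h : UpLe p G H) (h' : UpLe q G' H')
    (hH : Tempered p H) (hG' : Tempered q G') : UpLe (p ^^ q) (G + G') (H + H') := by
  refine (h.add_right hG').trans ?_
  rw [Bool.xor_comm, add_comm H, add_comm H]
  exact h'.add_right hH

/-- Used in both directions, this lets all options be replaced by counterparts in `classI` without
affecting sums where Left moves last. -/
theorem upLe_of_options {p : Bool} {G H : ScoringGame} (hG : G.left.Nonempty)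
    (hH : H.right.Nonempty) (hr : ∀ B ∈ H.right, ∃ A ∈ G.right, UpLe (!p) A B)
    (hl : ∀ A ∈ G.left, ∃ B ∈ H.left, UpLe (!p) A B) : UpLe p G H := by
  intro q X hX
  induction X using option_induction generalizing q with
  | _ X ihl ihr =>
  constructor
  · intro hpq
    obtain ⟨C, hC⟩ := hH
    refine le_rightOutcome ⟨_, add_mem_right_of_left hC X⟩ fun J hJ => ?_
    rcases mem_right_add.1 hJ with ⟨B, hB, rfl⟩ | ⟨Y, hY, rfl⟩
    · obtain ⟨A, hA, h⟩ := hr B hB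
      exact (rightOutcome_le_of_mem_right (add_mem_right_of_left hA X)).trans
        ((h q X hX).2 (by simp [hpq]))
    · exact (rightOutcome_le_of_mem_right (add_mem_right_of_right hY G)).trans
        ((ihr Y hY _ (hX.of_mem_right hY)).2 (by simp [hpq]))
  · intro hpq
    obtain ⟨C, hC⟩ := hG
    refine leftOutcome_le ⟨_, add_mem_left_of_left hC X⟩ fun J hJ => ?_
    rcases mem_left_add.1 hJ with ⟨A, hA, rfl⟩ | ⟨Y, hY, rfl⟩
    · obtain ⟨B, hB, h⟩ := hl A hA
      exact ((h q X hX).1 (by simp [hpq])).trans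
        (rightOutcome_le_of_mem_left (add_mem_left_of_left hB X))
    · exact ((ihl Y hY _ (hX.of_mem_left hY)).1 (by simp [hpq])).trans
        (rightOutcome_le_of_mem_left (add_mem_left_of_right hY H))

/-- When Left makes the last move overall, Left is never forced to open `G`, so the gap condition is
needed only below `G`, for the positions reached after Left's first reply there. -/
theorem upLe_of_le_rightOutcome {G : ScoringGame} (hG : Tempered false G)
    (hne : G.right.Nonempty) (hr : ∀ K ∈ G.right, K ∈ classI) :
    UpLe false (int G.rightOutcome) G := by
  intro q X hX
  rw [(outcomes_int_add hX _).1, (outcomes_int_add hX _).2]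
  induction X using option_induction generalizing q with
  | _ X ihl ihr =>
  constructor
  · intro hq
    obtain ⟨C, hC⟩ := hne
    refine le_rightOutcome ⟨_, add_mem_right_of_left hC X⟩ fun J hJ => ?_
    rcases mem_right_add.1 hJ with ⟨A, hA, rfl⟩ | ⟨Y, hY, rfl⟩
    · have hAo := hG.of_mem_right hA
      obtain ⟨A', hA', e⟩ := exists_leftOutcome_eq hAo.nonempty_of_true.1
      exact (outcomes_add_ge_of_le_rightOutcome (mem_classI_of_mem_left (hr A hA) hA')
        (hAo.of_mem_left hA') (e ▸ rightOutcome_le_of_mem_right hA) hX.isWellTempered).2.trans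
        (rightOutcome_le_of_mem_left (add_mem_left_of_left hA' X))
    · exact (add_le_add_right (rightOutcome_le_of_mem_right hY) _).trans
        ((ihr Y hY _ (hX.of_mem_right hY)).2 (by simpa using hq))
  · intro hq
    simp only [Bool.false_xor] at hq
    subst hq
    obtain ⟨Y, hY, e⟩ := exists_leftOutcome_eq hX.nonempty_of_true.1
    rw [e]
    exact ((ihl Y hY _ (hX.of_mem_left hY)).1 rfl).trans
      (rightOutcome_le_of_mem_left (add_mem_left_of_right hY G))

/-- Right plays well in `X`. If Left opens `G`, Right's reply holds Left to `L(G) ≤ R(G)`; if `X`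
ends first, it is Right's turn and opening `G` yields exactly `R(G)`. -/
theorem upLe_int_of_leftOutcome_le {G : ScoringGame} (hG : Tempered false G)
    (hl : ∀ K ∈ G.left, K ∈ classI) (hLR : G.leftOutcome ≤ G.rightOutcome) :
    UpLe false G (int G.rightOutcome) := by
  intro q X hX
  rw [(outcomes_int_add hX _).1, (outcomes_int_add hX _).2]
  induction X using option_induction generalizing q with
  | _ X ihl ihr =>
  constructor
  · intro hq
    rcases hX.isInt_or with ⟨-, m, rfl⟩ | ⟨-, hr⟩
    · rw [add_comm, (outcomes_int_add hG m).2, rightOutcome_int, add_comm]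
    · obtain ⟨Y, hY, e⟩ := exists_rightOutcome_eq hr
      rw [e]
      exact (rightOutcome_le_of_mem_right (add_mem_right_of_right hY G)).trans
        ((ihr Y hY _ (hX.of_mem_right hY)).2 (by simpa using hq))
  · intro hq
    simp only [Bool.false_xor] at hq
    subst hq
    obtain ⟨C, hC⟩ := hX.nonempty_of_true.1
    refine leftOutcome_le ⟨_, add_mem_left_of_right hC G⟩ fun J hJ => ?_
    rcases mem_left_add.1 hJ with ⟨A, hA, rfl⟩ | ⟨Y, hY, rfl⟩
    · have hAo := hG.of_mem_left hA
      obtain ⟨A', hA', e⟩ := exists_rightOutcome_eq hAo.nonempty_of_true.2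
      exact (rightOutcome_le_of_mem_right (add_mem_right_of_left hA' X)).trans
        (outcomes_add_le_of_leftOutcome_le (mem_classI_of_mem_right (hl A hA) hA')
          (hAo.of_mem_right hA') (e ▸ (rightOutcome_le_of_mem_left hA).trans hLR)
          hX.isWellTempered).1
    · exact ((ihl Y hY _ (hX.of_mem_left hY)).1 rfl).trans
        (add_le_add_right (rightOutcome_le_of_mem_left hY) _)

theorem exists_mem_classI_upLe {p : Bool} {G : ScoringGame} (hG : Tempered p G) :
    ∃ U ∈ classI, Tempered p U ∧ UpLe p G U ∧ UpLe p U G := by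
  induction G using option_induction generalizing p with
  | _ G ihl ihr =>
  rcases hG.isInt_or with ⟨rfl, n, rfl⟩ | ⟨hl, hr⟩
  · exact ⟨int n, mem_classI_int n, hG, fun _ _ _ => ⟨fun _ => le_rfl, fun _ => le_rfl⟩,
      fun _ _ _ => ⟨fun _ => le_rfl, fun _ => le_rfl⟩⟩
  -- The membership hypothesis sits inside the existential so that `choose` yields a function on all
  -- games; its value off the options is irrelevant.
  · have h : ∀ K : ScoringGame, ∃ U, K ∈ G.left ∪ G.right →
        U ∈ classI ∧ Tempered (!p) U ∧ UpLe (!p) K U ∧ UpLe (!p) U K := by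
      intro K
      by_cases hK : K ∈ G.left ∪ G.right
      · rcases Finset.mem_union.1 hK with hK' | hK'
        · obtain ⟨U, hU⟩ := ihl K hK' (hG.of_mem_left hK')
          exact ⟨U, fun _ => hU⟩
        · obtain ⟨U, hU⟩ := ihr K hK' (hG.of_mem_right hK')
          exact ⟨U, fun _ => hU⟩
      · exact ⟨0, fun h => absurd h hK⟩
    choose f hf using h
    have hfl : ∀ K ∈ G.left, _ := fun K hK => hf K (Finset.mem_union_left _ hK)
    have hfr : ∀ K ∈ G.right, _ := fun K hK => hf K (Finset.mem_union_right _ hK)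
    let V := node (G.left.image f) (G.right.image f)
    have hVl : V.left = G.left.image f := left_node _ _
    have hVr : V.right = G.right.image f := right_node _ _
    have hVln : V.left.Nonempty := hVl ▸ hl.image f
    have hVrn : V.right.Nonempty := hVr ▸ hr.image f
    have hlI : ∀ K ∈ V.left, K ∈ classI ∧ Tempered (!p) K := by
      rw [hVl, Finset.forall_mem_image]
      exact fun K hK => ⟨(hfl K hK).1, (hfl K hK).2.1⟩
    have hrI : ∀ K ∈ V.right, K ∈ classI ∧ Tempered (!p) K := by
      rw [hVr, Finset.forall_mem_image]
      exact fun K hK => ⟨(hfr K hK).1, (hfr K hK).2.1⟩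
    have hV : Tempered p V := tempered_of_options hVln hVrn (fun K hK => (hlI K hK).2)
      (fun K hK => (hrI K hK).2)
    have hGV : UpLe p G V := by
      refine upLe_of_options hl hVrn ?_ ?_
      · rw [hVr, Finset.forall_mem_image]
        exact fun K hK => ⟨K, hK, (hfr K hK).2.2.1⟩
      · rw [hVl]
        exact fun K hK => ⟨f K, Finset.mem_image_of_mem f hK, (hfl K hK).2.2.1⟩
    have hVG : UpLe p V G := by
      refine upLe_of_options hVln hr ?_ ?_
      · rw [hVr]
        exact fun K hK => ⟨f K, Finset.mem_image_of_mem f hK, (hfr K hK).2.2.2⟩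
      · rw [hVl, Finset.forall_mem_image]
        exact fun K hK => ⟨K, hK, (hfl K hK).2.2.2⟩
    by_cases hc : p = false → V.rightOutcome ≤ V.leftOutcome
    · exact ⟨V, mem_classI_of_options hV hc (fun K hK => (hlI K hK).1) (fun K hK => (hrI K hK).1),
        hV, hGV, hVG⟩
    -- Here `V` is even-tempered with `L(V) < R(V)`, so nobody wants to open it; with Left moving
    -- last, Right must, and `V` is worth `R(V)`.
    · simp only [not_forall, not_le] at hc
      obtain ⟨rfl, hlt⟩ := hc
      exact ⟨int V.rightOutcome, mem_classI_int _, tempered_int _,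
        hGV.trans (upLe_int_of_leftOutcome_le hV (fun K hK => (hlI K hK).1) hlt.le),
        (upLe_of_le_rightOutcome hV hVrn (fun K hK => (hrI K hK).1)).trans hVG⟩

theorem equivalent_zero_of_upLe {J K : ScoringGame} (hJ : Equivalent J 0) (hK : K ∈ classI)
    (he : Tempered false K) (h1 : UpLe false J K) (h2 : UpLe false K J) : Equivalent K 0 := by
  refine equivalent_iff_ge.2 ⟨ge_zero_of_rightOutcome_nonneg hK he ?_,
    zero_ge_of_leftOutcome_nonpos hK he ?_⟩
  · have h3 := (h1 _ _ (tempered_int 0)).1 rfl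
    rw [(hJ _ (tempered_int 0).isWellTempered).2, zero_add, ← zero_def, add_zero] at h3
    simpa [zero_def] using h3
  -- The left outcome of `K` is not directly visible to `UpLe`; testing against `-K` turns it into a
  -- right outcome: `0 ≤ R(K + -K) ≤ R(J + -K) = -L(K)`.
  · have h3 := (rightOutcome_add_neg_self_nonneg hK.1).trans ((h2 _ _ he.neg).1 rfl)
    rw [(hJ _ hK.1.neg).2, zero_add, rightOutcome_neg hK.1] at h3
    linarith

theorem IsInvertible.exists_mem_classI_equivalent {G : ScoringGame} (hG : G.IsWellTempered)
    (hinv : G.IsInvertible) : ∃ U ∈ classI, Equivalent U G := by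
  obtain ⟨H, hH, h0⟩ := hinv
  rw [← zero_def] at h0
  obtain ⟨p, hp⟩ := isWellTempered_iff.1 hG
  obtain ⟨q, hq⟩ := isWellTempered_iff.1 hH
  obtain rfl : p = q := by
    have := h0.parity_eq (hp.add hq) (tempered_int 0)
    simpa using this
  have h0' : Equivalent (-G + -H) 0 := by
    have := h0.neg (hG.add hH) (tempered_int 0).isWellTempered
    rwa [game_neg_add, neg_int, neg_zero] at this
  obtain ⟨U, hU, hUp, hGU, hUG⟩ := exists_mem_classI_upLe hp
  obtain ⟨U', hU', hUp', hHU, hUH⟩ := exists_mem_classI_upLe hq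
  obtain ⟨V, hV, hVp, hGV, hVG⟩ := exists_mem_classI_upLe hp.neg
  obtain ⟨V', hV', hVp', hHV, hVH⟩ := exists_mem_classI_upLe hq.neg
  have even_add : ∀ {A B : ScoringGame}, Tempered p A → Tempered p B → Tempered false (A + B) :=
    fun hA hB => by simpa using hA.add hB
  have up_add : ∀ {A B A' B' : ScoringGame}, UpLe p A B → UpLe p A' B' → Tempered p B →
      Tempered p A' → UpLe false (A + A') (B + B') := fun h h' hB hA' => by
    simpa using h.add h' hB hA'
  have hUU : Equivalent (U + U') 0 := equivalent_zero_of_upLe h0 (mem_classI_add hU hU')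
    (even_add hUp hUp') (up_add hGU hHU hUp hq) (up_add hUG hUH hp hUp')
  have hVV : Equivalent (V + V') 0 := equivalent_zero_of_upLe h0' (mem_classI_add hV hV')
    (even_add hVp hVp') (up_add hGV hHV hVp hq.neg) (up_add hVG hVH hp.neg hVp')
  have nonneg : ∀ {A B C : ScoringGame}, Tempered p A → Tempered p B → Tempered p C →
      UpLe p A B → UpLe p (-A) C → 0 ≤ (B + C).rightOutcome := by
    intro A B C hA hB hC h1 h2
    have h3 := (h1 _ _ hC).1 (by simp)
    have h4 := (h2 _ _ hA).1 (by simp)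
    rw [add_comm, add_comm C] at h4
    exact (rightOutcome_add_neg_self_nonneg hA.isWellTempered).trans (h4.trans h3)
  have hUV := nonneg hp hUp hVp hGU hGV
  have hUV' := ge_zero_of_rightOutcome_nonneg (mem_classI_add hU' hV') (even_add hUp' hVp')
    (nonneg hq hUp' hVp' hHU hHV)
  -- `U + U' + V + V' ≈ 0` while `U' + V' ≳ 0`, so `U + V` can be at most zero.
  have hle : Ge 0 (U + V) := by
    have h1 := (equivalent_iff_ge.1 hVV).2.trans
      (by simpa using (equivalent_iff_ge.1 hUU).2.add_right (hV.1.add hV'.1))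
    have h2 := hUV'.add_right (hU.1.add hV.1)
    rw [zero_add, add_comm, add_add_add_comm] at h2
    exact h1.trans h2
  have hle' : (U + V).leftOutcome ≤ 0 := by
    simpa [zero_def] using hle.leftOutcome_le
  have hUV2 : Equivalent U (-V) := by
    refine equivalent_iff_ge.2 ⟨(ge_iff_rightOutcome_nonneg hU (mem_classI_neg hV) hUp hVp.neg).2
      (by rwa [neg_neg]), (ge_iff_rightOutcome_nonneg (mem_classI_neg hV) hU hVp.neg hUp).2 ?_⟩
    rw [← game_neg_add, rightOutcome_neg (hV.1.add hU.1), add_comm]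
    linarith
  refine ⟨U, hU, fun X hX => ?_⟩
  obtain ⟨r, hr⟩ := isWellTempered_iff.1 hX
  have e : ∀ K : ScoringGame, K + X = -(-K + -X) := fun K => by
    rw [← game_neg_add, neg_neg]
  -- The parity of the sum decides which outcome has Left moving last. That one is read off `U`; the
  -- other is read off `-V` after negating the whole sum.
  cases hpr : (p ^^ r) with
  | false =>
    refine ⟨?_, le_antisymm ((hUG _ _ hr).1 hpr) ((hGU _ _ hr).1 hpr)⟩
    rw [(hUV2 X hX).1, e, e G, leftOutcome_neg (hV.1.neg.neg.add hX.neg),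
      leftOutcome_neg (hG.neg.add hX.neg), neg_neg,
      le_antisymm ((hGV _ _ hr.neg).1 hpr) ((hVG _ _ hr.neg).1 hpr)]
  | true =>
    refine ⟨le_antisymm ((hUG _ _ hr).2 hpr) ((hGU _ _ hr).2 hpr), ?_⟩
    rw [(hUV2 X hX).2, e, e G, rightOutcome_neg (hV.1.neg.neg.add hX.neg),
      rightOutcome_neg (hG.neg.add hX.neg), neg_neg,
      le_antisymm ((hGV _ _ hr.neg).2 hpr) ((hVG _ _ hr.neg).2 hpr)]

/-! ### Uniqueness of canonical games -/

theorem IsCanonical.of_mem_left {G K : ScoringGame} (h : G.IsCanonical) (hK : K ∈ G.left) :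
    K.IsCanonical :=
  ⟨mem_classI_of_mem_left h.1 hK, fun H hH => h.2 H (hH.left hK)⟩

theorem IsCanonical.of_mem_right {G K : ScoringGame} (h : G.IsCanonical) (hK : K ∈ G.right) :
    K.IsCanonical :=
  ⟨mem_classI_of_mem_right h.1 hK, fun H hH => h.2 H (hH.right hK)⟩

/-- Irreversibility of `A` forces some `B ≳ A` in `H`, and irreversibility of `B` forces some `C ≳
B` in `G`; since `A` is not dominated, `C = A`. -/
theorem IsCanonical.exists_equivalent_of_mem_left {p : Bool} {G H A : ScoringGame}
    (hG : G.IsCanonical) (hH : H.IsCanonical) (hp : Tempered p G) (hq : Tempered p H)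
    (h : Equivalent G H) (hA : A ∈ G.left) : ∃ B ∈ H.left, Equivalent A B := by
  obtain ⟨h1, h2⟩ := equivalent_iff_ge.1 h
  have hGA := (hG.2 G IsSubgame.refl).1 A hA
  rcases h2.left_move hH.1 hG.1 hq hp hA with ⟨B, hB, hBA⟩ | ⟨A', hA', h3⟩
  · have hHB := (hH.2 H IsSubgame.refl).1 B hB
    rcases h1.left_move hG.1 hH.1 hp hq hB with ⟨C, hC, hCB⟩ | ⟨B', hB', h3⟩
    · have hCA : C = A := by
        by_contra hne
        exact hGA.2 ⟨C, hC, hne, hCB.trans hBA⟩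
      exact ⟨B, hB, equivalent_iff_ge.2 ⟨hCA ▸ hCB, hBA⟩⟩
    · exact absurd ⟨B', hB', h2.trans h3⟩ hHB.1
  · exact absurd ⟨A', hA', h1.trans h3⟩ hGA.1

theorem IsCanonical.exists_equivalent_of_mem_right {p : Bool} {G H A : ScoringGame}
    (hG : G.IsCanonical) (hH : H.IsCanonical) (hp : Tempered p G) (hq : Tempered p H)
    (h : Equivalent G H) (hA : A ∈ G.right) : ∃ B ∈ H.right, Equivalent A B := by
  obtain ⟨h1, h2⟩ := equivalent_iff_ge.1 h
  have hGA := (hG.2 G IsSubgame.refl).2 A hA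
  rcases h1.right_move hG.1 hH.1 hp hq hA with ⟨B, hB, hAB⟩ | ⟨A', hA', h3⟩
  · have hHB := (hH.2 H IsSubgame.refl).2 B hB
    rcases h2.right_move hH.1 hG.1 hq hp hB with ⟨C, hC, hBC⟩ | ⟨B', hB', h3⟩
    · have hCA : C = A := by
        by_contra hne
        exact hGA.2 ⟨C, hC, hne, hAB.trans hBC⟩
      exact ⟨B, hB, equivalent_iff_ge.2 ⟨hAB, hCA ▸ hBC⟩⟩
    · exact absurd ⟨B', hB', h3.trans h1⟩ hHB.1
  · exact absurd ⟨A', hA', h3.trans h2⟩ hGA.1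

theorem IsCanonical.eq_of_equivalent {G H : ScoringGame} (hG : G.IsCanonical)
    (hH : H.IsCanonical) (h : Equivalent G H) : G = H := by
  obtain ⟨p, hp⟩ := isWellTempered_iff.1 hG.1.1
  obtain ⟨q, hq⟩ := isWellTempered_iff.1 hH.1.1
  obtain rfl := h.parity_eq hp hq
  induction G using option_induction generalizing H p with
  | _ G ihl ihr =>
  have key : ∀ {A B : ScoringGame}, A ∈ G.left → B ∈ H.left → Equivalent A B → A = B :=
    fun hA hB hAB => ihl _ hA (hG.of_mem_left hA) (hH.of_mem_left hB) hAB _ (hp.of_mem_left hA)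
      (hq.of_mem_left hB)
  have key' : ∀ {A B : ScoringGame}, A ∈ G.right → B ∈ H.right → Equivalent A B → A = B :=
    fun hA hB hAB => ihr _ hA (hG.of_mem_right hA) (hH.of_mem_right hB) hAB _ (hp.of_mem_right hA)
      (hq.of_mem_right hB)
  have hl : G.left = H.left := by
    ext A
    constructor
    · intro hA
      obtain ⟨B, hB, hAB⟩ := hG.exists_equivalent_of_mem_left hH hp hq h hA
      exact key hA hB hAB ▸ hB
    · intro hA
      obtain ⟨B, hB, hAB⟩ := hH.exists_equivalent_of_mem_left hG hq hp h.symm hA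
      exact key hB hA hAB.symm ▸ hB
  have hr : G.right = H.right := by
    ext A
    constructor
    · intro hA
      obtain ⟨B, hB, hAB⟩ := hG.exists_equivalent_of_mem_right hH hp hq h hA
      exact key' hA hB hAB ▸ hB
    · intro hA
      obtain ⟨B, hB, hAB⟩ := hH.exists_equivalent_of_mem_right hG hq hp h.symm hA
      exact key' hB hA hAB.symm ▸ hB
  -- Equal option sets do not distinguish integers from each other; their outcomes do.
  rcases hp.isInt_or with ⟨-, m, rfl⟩ | ⟨⟨A, hA⟩, -⟩
  · rcases hq.isInt_or with ⟨-, n, rfl⟩ | ⟨⟨B, hB⟩, -⟩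
    · have h1 := (equivalent_iff_ge.1 h).1.leftOutcome_le
      have h2 := (equivalent_iff_ge.1 h).2.leftOutcome_le
      simp only [leftOutcome_int] at h1 h2
      rw [le_antisymm h2 h1]
    · rw [← hl] at hB
      simp at hB
  · exact ext_of_not_isInt (not_isInt_of_mem_left hA) (not_isInt_of_mem_left (hl ▸ hA)) hl hr

/-! ### Existence of canonical games -/

/-- The number of nodes of the game tree. -/
noncomputable def size (G : ScoringGame) : ℕ :=
  1 + ∑ K ∈ G.left.attach, size K.1 + ∑ K ∈ G.right.attach, size K.1
termination_by G.height
decreasing_by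
  · exact height_lt_of_mem_left K.2
  · exact height_lt_of_mem_right K.2

theorem size_eq (G : ScoringGame) :
    G.size = 1 + ∑ K ∈ G.left, K.size + ∑ K ∈ G.right, K.size := by
  rw [size.eq_def, Finset.sum_attach G.left size, Finset.sum_attach G.right size]

theorem size_pos (G : ScoringGame) : 0 < G.size := by
  rw [size_eq]
  omega

theorem size_int (n : ℤ) : (int n).size = 1 := by
  rw [size_eq]
  simp

theorem size_neg (G : ScoringGame) : (-G).size = G.size := by
  induction G using option_induction with
  | _ G ihl ihr =>
  rw [size_eq, size_eq G, left_neg, right_neg, Finset.sum_image neg_injective.injOn,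
    Finset.sum_image neg_injective.injOn, Finset.sum_congr rfl ihl, Finset.sum_congr rfl ihr]
  exact add_right_comm _ _ _

theorem sum_size_union_le (s t : Finset ScoringGame) :
    ∑ K ∈ s ∪ t, K.size ≤ ∑ K ∈ s, K.size + ∑ K ∈ t, K.size := by
  rw [← Finset.sum_union_inter]
  exact Nat.le_add_right _ _

/-- `G` has even gap zero, and it is a smallest such game in its equivalence class. -/
def IsMinimal (G : ScoringGame) : Prop :=
  G ∈ classI ∧ ∀ H ∈ classI, Equivalent H G → G.size ≤ H.size

theorem exists_isMinimal {G : ScoringGame} (hG : G ∈ classI) :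
    ∃ H, H.IsMinimal ∧ Equivalent H G := by
  induction hn : G.size using Nat.strong_induction_on generalizing G with
  | _ n ih =>
  subst hn
  by_cases h : G.IsMinimal
  · exact ⟨G, h, fun _ _ => ⟨rfl, rfl⟩⟩
  · simp only [IsMinimal, not_and, not_forall, not_le] at h
    obtain ⟨H, hH, he, hlt⟩ := h hG
    obtain ⟨K, hK, hKH⟩ := ih _ hlt hH rfl
    exact ⟨K, hK, hKH.trans he⟩

-- Minimal games are canonical.

theorem IsMinimal.neg {G : ScoringGame} (hG : G.IsMinimal) : (-G).IsMinimal := by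
  refine ⟨mem_classI_neg hG.1, fun H hH he => ?_⟩
  have h := hG.2 _ (mem_classI_neg hH) (by simpa using he.neg hH.1 hG.1.1.neg)
  rwa [size_neg] at h ⊢

/-- Changing the left options of a game with even gap zero keeps it in the class, provided that
the left outcome does not drop. -/
theorem node_left_mem_classI {p : Bool} {G : ScoringGame} (hG : G ∈ classI) (hp : Tempered p G)
    (hne : G.left.Nonempty) {l : Finset ScoringGame}
    (hl : ∀ A ∈ l, A ∈ classI ∧ Tempered (!p) A)
    (hle : ∀ A ∈ G.left, A.rightOutcome = G.leftOutcome → ∃ B ∈ l, A.rightOutcome ≤ B.rightOutcome) :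
    node l G.right ∈ classI ∧ Tempered p (node l G.right) := by
  -- An option attaining `L(G)` is enough: its counterpart in `l` keeps the new left outcome at
  -- least `L(G) ≥ R(G)`.
  obtain ⟨A, hA, e⟩ := exists_leftOutcome_eq hne
  obtain ⟨B, hB, hAB⟩ := hle A hA e.symm
  have hr := (hp.isInt_or.resolve_left fun h => not_isInt_of_mem_left hA h.2).2
  have ht : Tempered p (node l G.right) := by
    refine tempered_of_options ?_ ?_ ?_ ?_
    · rw [left_node]; exact ⟨B, hB⟩
    · rwa [right_node]
    · rw [left_node]; exact fun K hK => (hl K hK).2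
    · rw [right_node]; exact fun K hK => hp.of_mem_right hK
  refine ⟨mem_classI_of_options ht ?_ ?_ ?_, ht⟩
  · rintro rfl
    have h1 : G.rightOutcome ≤ G.leftOutcome := rightOutcome_le_leftOutcome_of_mem_classI hG hp
    have h2 : (node l G.right).rightOutcome ≤ G.rightOutcome :=
      le_rightOutcome hr fun K hK => rightOutcome_le_of_mem_right (by rwa [right_node])
    have h3 : B.rightOutcome ≤ (node l G.right).leftOutcome :=
      rightOutcome_le_of_mem_left (by rwa [left_node])
    linarith
  · rw [left_node]; exact fun K hK => (hl K hK).1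
  · rw [right_node]; exact fun K hK => mem_classI_of_mem_right hG hK

theorem size_node (l r : Finset ScoringGame) :
    (node l r).size = 1 + ∑ K ∈ l, K.size + ∑ K ∈ r, K.size := by
  rw [size_eq, left_node, right_node]

/-- Replacing `K` by a smaller equivalent `K'` would give a smaller game equivalent to `G`. -/
theorem IsMinimal.of_mem_left {G K : ScoringGame} (hG : G.IsMinimal) (hK : K ∈ G.left) :
    K.IsMinimal := by
  have hKI := mem_classI_of_mem_left hG.1 hK
  refine ⟨hKI, fun K' hK' he => ?_⟩
  by_contra! hlt
  obtain ⟨p, hp⟩ := isWellTempered_iff.1 hG.1.1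
  obtain ⟨q, hq⟩ := isWellTempered_iff.1 hK'.1
  obtain rfl := he.parity_eq hq (hp.of_mem_left hK)
  obtain ⟨h1, h2⟩ := equivalent_iff_ge.1 he
  have hl : ∀ A ∈ insert K' (G.left.erase K), A ∈ classI ∧ Tempered (!p) A := by
    intro A hA
    rcases Finset.mem_insert.1 hA with rfl | hA
    · exact ⟨hK', hq⟩
    · have hA' := Finset.mem_of_mem_erase hA
      exact ⟨mem_classI_of_mem_left hG.1 hA', hp.of_mem_left hA'⟩
  have hmem : ∀ A ∈ G.left, ∃ B ∈ insert K' (G.left.erase K), Ge B A ∧ Ge A B := by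
    intro A hA
    by_cases hAK : A = K
    · exact ⟨K', Finset.mem_insert_self _ _, hAK ▸ ⟨h1, h2⟩⟩
    · exact ⟨A, Finset.mem_insert_of_mem (Finset.mem_erase.2 ⟨hAK, hA⟩), Ge.refl A, Ge.refl A⟩
  obtain ⟨hHI, hHt⟩ := node_left_mem_classI hG.1 hp ⟨K, hK⟩ hl fun A hA _ =>
    (hmem A hA).imp fun B hB => ⟨hB.1, hB.2.1.rightOutcome_le⟩
  have h := hG.2 _ hHI (equivalent_iff_ge.2 ⟨?_, ?_⟩)
  · rw [size_node, size_eq G, ← Finset.add_sum_erase _ size hK] at h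
    -- Only an inequality, since `K'` may already be an option of `G`.
    have h3 : ∑ A ∈ insert K' (G.left.erase K), A.size ≤ K'.size + ∑ A ∈ G.left.erase K, A.size :=
      (sum_size_union_le {K'} _).trans_eq (by rw [Finset.sum_singleton])
    omega
  · refine ge_of_moves hHI hG.1 hHt hp (Or.inr ⟨K, hK⟩) ?_ ?_
    · rw [right_node]; exact fun A hA => Or.inl ⟨A, hA, Ge.refl A⟩
    · rw [left_node]
      exact fun A hA => Or.inl ((hmem A hA).imp fun B hB => ⟨hB.1, hB.2.1⟩)
  · refine ge_of_moves hG.1 hHI hp hHt (Or.inr (by rw [left_node]; simp)) ?_ ?_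
    · rw [right_node]; exact fun A hA => Or.inl ⟨A, hA, Ge.refl A⟩
    · rw [left_node]
      intro B hB
      rcases Finset.mem_insert.1 hB with rfl | hB
      · exact Or.inl ⟨K, hK, h2⟩
      · exact Or.inl ⟨B, Finset.mem_of_mem_erase hB, Ge.refl B⟩

theorem IsMinimal.of_mem_right {G K : ScoringGame} (hG : G.IsMinimal) (hK : K ∈ G.right) :
    K.IsMinimal := by
  simpa using (hG.neg.of_mem_left (neg_mem_left_neg.2 hK)).neg

theorem IsMinimal.of_isSubgame {G H : ScoringGame} (hG : G.IsMinimal) (h : IsSubgame H G) :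
    H.IsMinimal := by
  induction h with
  | refl => exact hG
  | left hK _ ih => exact ih (hG.of_mem_left hK)
  | right hK _ ih => exact ih (hG.of_mem_right hK)

theorem IsMinimal.not_leftDominated {G K : ScoringGame} (hG : G.IsMinimal) (hK : K ∈ G.left) :
    ¬ LeftDominated G K := by
  rintro ⟨M, hM, hMK, hge⟩
  obtain ⟨p, hp⟩ := isWellTempered_iff.1 hG.1.1
  have hl : ∀ A ∈ G.left.erase K, A ∈ classI ∧ Tempered (!p) A := by
    intro A hA
    have hA' := Finset.mem_of_mem_erase hA
    exact ⟨mem_classI_of_mem_left hG.1 hA', hp.of_mem_left hA'⟩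
  have hM' : M ∈ G.left.erase K := Finset.mem_erase.2 ⟨hMK, hM⟩
  have hmem : ∀ A ∈ G.left, ∃ B ∈ G.left.erase K, Ge B A := by
    intro A hA
    by_cases hAK : A = K
    · exact ⟨M, hM', hAK ▸ hge⟩
    · exact ⟨A, Finset.mem_erase.2 ⟨hAK, hA⟩, Ge.refl A⟩
  obtain ⟨hHI, hHt⟩ := node_left_mem_classI hG.1 hp ⟨K, hK⟩ hl fun A hA _ =>
    (hmem A hA).imp fun B hB => ⟨hB.1, hB.2.rightOutcome_le⟩
  have h := hG.2 _ hHI (equivalent_iff_ge.2 ⟨?_, ?_⟩)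
  · rw [size_node, size_eq G, ← Finset.add_sum_erase _ size hK] at h
    have := K.size_pos
    omega
  · refine ge_of_moves hHI hG.1 hHt hp (Or.inr ⟨K, hK⟩) ?_ ?_
    · rw [right_node]; exact fun A hA => Or.inl ⟨A, hA, Ge.refl A⟩
    · rw [left_node]; exact fun A hA => Or.inl (hmem A hA)
  · refine ge_of_moves hG.1 hHI hp hHt (Or.inr ⟨M, by rwa [left_node]⟩) ?_ ?_
    · rw [right_node]; exact fun A hA => Or.inl ⟨A, hA, Ge.refl A⟩
    · rw [left_node]
      exact fun B hB => Or.inl ⟨B, Finset.mem_of_mem_erase hB, Ge.refl B⟩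

/-- Bypassing replaces `K` by the left options of `M`. This lowers the size because these are only
part of the tree of `M`, which is itself part of that of `K`. -/
theorem IsMinimal.not_leftReversible {G K : ScoringGame} (hG : G.IsMinimal) (hK : K ∈ G.left) :
    ¬ LeftReversible G K := by
  rintro ⟨M, hM, hge⟩
  obtain ⟨p, hp⟩ := isWellTempered_iff.1 hG.1.1
  have hKI := mem_classI_of_mem_left hG.1 hK
  have hMI := mem_classI_of_mem_right hKI hM
  have hMt : Tempered p M := by simpa using (hp.of_mem_left hK).of_mem_right hM
  have hRK := rightOutcome_le_of_mem_right hM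
  have hr := (hp.isInt_or.resolve_left fun h => not_isInt_of_mem_left hK h.2).2
  have hl : ∀ A ∈ G.left.erase K ∪ M.left, A ∈ classI ∧ Tempered (!p) A := by
    intro A hA
    rcases Finset.mem_union.1 hA with hA | hA
    · have hA' := Finset.mem_of_mem_erase hA
      exact ⟨mem_classI_of_mem_left hG.1 hA', hp.of_mem_left hA'⟩
    · exact ⟨mem_classI_of_mem_left hMI hA, hMt.of_mem_left hA⟩
  have hmem : ∀ A ∈ G.left, A ≠ K → A ∈ G.left.erase K ∪ M.left := fun A hA hAK =>
    Finset.mem_union_left _ (Finset.mem_erase.2 ⟨hAK, hA⟩)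
  have hout : ∀ A ∈ G.left, A.rightOutcome = G.leftOutcome →
      ∃ B ∈ G.left.erase K ∪ M.left, A.rightOutcome ≤ B.rightOutcome := by
    intro A hA hAG
    by_cases hAK : A = K
    · subst hAK
      -- If `M` is an integer `n`, it offers no replacement. But then `L(G) = R(K) ≤ n` gives `G ≲
      -- n`, so `G ≈ n`, and `n` is smaller than `G`.
      rcases hMt.isInt_or with ⟨rfl, n, rfl⟩ | ⟨hMl, -⟩
      · exfalso
        rw [leftOutcome_int] at hRK
        have hGn : Ge (int n) G := by
          refine (ge_iff_rightOutcome_nonneg hMI hG.1 hMt hp).2 ?_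
          rw [(outcomes_int_add hp.neg n).2, rightOutcome_neg hG.1.1]
          linarith
        have h := hG.2 _ hMI (equivalent_iff_ge.2 ⟨hGn, hge⟩)
        rw [size_int, size_eq, ← Finset.add_sum_erase _ size hK] at h
        have := A.size_pos
        omega
      · obtain ⟨B, hB, e⟩ := exists_leftOutcome_eq hMl
        exact ⟨B, Finset.mem_union_right _ hB, e ▸ hRK⟩
    · exact ⟨A, hmem A hA hAK, le_rfl⟩
  obtain ⟨hHI, hHt⟩ := node_left_mem_classI hG.1 hp ⟨K, hK⟩ hl hout
  have hHr : (node (G.left.erase K ∪ M.left) G.right).right.Nonempty := by rwa [right_node]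
  have h := hG.2 _ hHI (equivalent_iff_ge.2 ⟨?_, ?_⟩)
  · rw [size_node, size_eq G, ← Finset.add_sum_erase _ size hK, size_eq K,
      ← Finset.add_sum_erase _ size hM, size_eq M] at h
    have h3 : ∑ A ∈ G.left.erase K ∪ M.left, A.size ≤
        ∑ A ∈ G.left.erase K, A.size + ∑ A ∈ M.left, A.size :=
      sum_size_union_le _ _
    omega
  · refine ge_of_moves hHI hG.1 hHt hp (Or.inl hHr) ?_ ?_
    · rw [right_node]; exact fun A hA => Or.inl ⟨A, hA, Ge.refl A⟩
    · intro B hB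
      by_cases hBK : B = K
      · subst hBK
        -- Right answers the lost option `K` with `M`, so the new game must be `≳ M`: its right
        -- options are those of `G`, handled by `G ≳ M`, and it has every left option of `M`.
        refine Or.inr ⟨M, hM, ge_of_moves hHI hMI hHt hMt (Or.inl hHr) ?_ ?_⟩
        · rw [right_node]
          exact fun A hA => hge.right_move hG.1 hMI hp hMt hA
        · rw [left_node]
          exact fun C hC => Or.inl ⟨C, Finset.mem_union_right _ hC, Ge.refl C⟩
      · rw [left_node]
        exact Or.inl ⟨B, hmem B hB hBK, Ge.refl B⟩
  · refine ge_of_moves hG.1 hHI hp hHt (Or.inl hr) ?_ ?_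
    · rw [right_node]; exact fun A hA => Or.inl ⟨A, hA, Ge.refl A⟩
    · rw [left_node]
      intro B hB
      rcases Finset.mem_union.1 hB with hB | hB
      · exact Or.inl ⟨B, Finset.mem_of_mem_erase hB, Ge.refl B⟩
      -- The inherited options give Left nothing new, because `G ≳ M` already answers every left
      -- option of `M`.
      · exact hge.left_move hG.1 hMI hp hMt hB

theorem IsMinimal.not_rightDominated {G K : ScoringGame} (hG : G.IsMinimal) (hK : K ∈ G.right) :
    ¬ RightDominated G K := by
  rintro ⟨M, hM, hMK, hge⟩
  exact hG.neg.not_leftDominated (neg_mem_left_neg.2 hK) ⟨-M, neg_mem_left_neg.2 hM,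
    fun h => hMK (neg_injective h), hge.neg (mem_classI_of_mem_right hG.1 hK).1
      (mem_classI_of_mem_right hG.1 hM).1⟩

theorem IsMinimal.not_rightReversible {G K : ScoringGame} (hG : G.IsMinimal) (hK : K ∈ G.right) :
    ¬ RightReversible G K := by
  rintro ⟨M, hM, hge⟩
  exact hG.neg.not_leftReversible (neg_mem_left_neg.2 hK) ⟨-M, neg_mem_right_neg.2 hM,
    hge.neg (mem_classI_of_mem_left (mem_classI_of_mem_right hG.1 hK) hM).1 hG.1.1⟩

theorem IsMinimal.isCanonical {G : ScoringGame} (hG : G.IsMinimal) : G.IsCanonical :=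
  ⟨hG.1, fun _ hH => ⟨fun _ hK => ⟨(hG.of_isSubgame hH).not_leftReversible hK,
    (hG.of_isSubgame hH).not_leftDominated hK⟩, fun _ hK =>
    ⟨(hG.of_isSubgame hH).not_rightReversible hK, (hG.of_isSubgame hH).not_rightDominated hK⟩⟩⟩

end ScoringGame

theorem mainTheorem8 (G : ScoringGame) (hG : G.IsWellTempered) (hinv : G.IsInvertible) :
    ∃! H : ScoringGame, H ∈ ScoringGame.classI ∧ H.Equivalent G ∧ H.IsCanonical := by
  obtain ⟨U, hU, hUG⟩ := hinv.exists_mem_classI_equivalent hG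
  obtain ⟨H, hH, hHU⟩ := ScoringGame.exists_isMinimal hU
  exact ⟨H, ⟨hH.1, hHU.trans hUG, hH.isCanonical⟩, fun K ⟨_, hKG, hK⟩ =>
    hK.eq_of_equivalent hH.isCanonical (hKG.trans (hHU.trans hUG).symm)⟩
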